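/- **Setting.** Let $J\ge 2$ and $[J]=\{1,\dots,J\}$. For each $j\in[J]$ a stream $X^j=(X^j_1,X^j_2,\dots)$ has law $P^j_0$ ("noise") or $P^j_1$ ("signal"); $P_0^j\ne P_1^j$ are known and mutually absolutely continuous on the first $n$ observations, for every $n$. Let $\lambda^j(n)$ be the logarithm of the density ratio of $P_1^j$ to $P_0^j$ on the first $n$ observations, and assume $\lambda^j(n)\to-\infty$ $P^j_0$-a.s. and $\lambda^j(n)\to\infty$ $P_1^j$-a.s. For $A\subseteq[J]$ let $P_A=\bigotimes_{j}P^j_{\mathbf 1\{j\in A\}}$ (independent streams, signal set $A$), with expectation $E_A$. A procedure $(T,D)$ is a stopping time $T\in\{0,1,\dots,\infty\}$ of the filtration $\sigma_n$ generated by the first $n$ observations of all streams, together with a $\sigma_T$-measurable $D\subseteq[J]$ (the streams declared signals). Put $\mathrm{FWE}_{1,A}(T,D)=P_A(D\not\subseteq A)$ and $\mathrm{FWE}_{2,A}(T,D)=P_A(A\not\subseteq D)$. A multiple testing error metric $\mathrm{MTE}$ assigns to each $A$ and each procedure two numbers $\mathrm{MTE}_{1,A},\mathrm{MTE}_{2,A}\in[0,1]$.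 For a class $\mathcal P$ of signal sets, $\Delta^{\mathrm{MTE}}_{\mathcal P}(\alpha,\beta)$ is the set of procedures with $\mathrm{MTE}_{1,A}\le\alpha$ and $\mathrm{MTE}_{2,A}\le\beta$ for all $A\in\mathcal P$. For $1\le m\le J-1$ let $\mathcal P_m=\{A\subseteq[J]:|A|=m\}$; the gap rule $(T_G(c),D_G(c))$ stops at the first $n\ge1$ at which the $m$-th largest of the $\lambda^j(n)$ exceeds the $(m+1)$-st largest by at least $c$, and declares the $m$ streams with the largest values to be signals. When the observations are i.i.d. within streams put $I_0^j=E_{P_0^j}[-\lambda^j(1)]$, $I_1^j=E_{P_1^j}[\lambda^j(1)]$, let $v_0^j,v_1^j$ be the variances of $\lambda^j(1)$ under $P_0^j,P_1^j$, and put $\eta_1^A=\min_{j\in A}I_1^j$, $\eta_0^A=\min_{j\notin A}I_0^j$. **Theorem.** Let $1\le m\le J-1$, let $C_1,C_2>0$, and let $\mathrm{MTE}$ be a metric such that, for $i=1,2$ and all $A\in\mathcal P_m$, (i) $\mathrm{MTE}_{i,A}\le C_1\,\mathrm{FWE}_{i,A}$ at $(T_G(c),D_G(c))$ for all $c>0$,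 and (ii) $\mathrm{MTE}_{i,A}\ge C_2\,\mathrm{FWE}_{i,A}$ at every procedure. For $\alpha,\beta\in(0,1)$ let $(T_G^*,D_G^*)$ be the gap rule with threshold $c=|\log((\alpha/C_1)\wedge(\beta/C_1))|+\log(m(J-m))$. (1) If $c>0$, then $(T_G^*,D_G^*)\in\Delta^{\mathrm{MTE}}_{\mathcal P_m}(\alpha,\beta)$. (2) If moreover the observations within each stream are i.i.d. and all $I_0^j,I_1^j$ are finite, then for all $A\in\mathcal P_m$, as $\alpha,\beta\to0$ at arbitrary rates, $$E_A(T_G^*)\sim\frac{|\log(\alpha\wedge\beta)|}{\eta_1^A+\eta_0^A}\sim\inf_{(T,D)\in\Delta^{\mathrm{MTE}}_{\mathcal P_m}(\alpha,\beta)}E_A(T).$$ (3) Let $J$, $m$, $C_1$, $C_2$, the laws of the streams and $\mathrm{MTE}$ vary with $\alpha,\beta$, with (i) and (ii) in force for each $(\alpha,\beta)$. Then (1) still holds. The asymptotic equivalences in (2) also still hold, for every choice of signal sets $A=A(\alpha,\beta)\in\mathcal P_m$ with $\eta_1^A+\eta_0^A$ bounded above, provided the observations within each stream are i.i.d., $J=o(|\log(\alpha\wedge\beta)|^{1/4})$,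 $\log C_1=o(|\log(\alpha\wedge\beta)|)$, $\log C_2^{-1}=o(|\log(\alpha\wedge\beta)|)$, $(\alpha\vee\beta)/C_2\to0$, the numbers $I_0^j,I_1^j$ are bounded below by a positive constant, and the variances $v_0^j,v_1^j$ are bounded above, uniformly in $j$, $\alpha$, $\beta$. -/

import Mathlib

open MeasureTheory ProbabilityTheory Filter Topology Asymptotics
open scoped ENNReal

universe u v

/-- The first `n` observations of a single stream; `x i` is the observation at time `i + 1`. -/
def streamPrefix {X : Type u} (n : ℕ) (x : ℕ → X) : Fin n → X := fun i => x i

lemma measurable_streamPrefix {X : Type u} [MeasurableSpace X] (n : ℕ) :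
    Measurable (streamPrefix (X := X) n) :=
  measurable_pi_lambda _ fun i => measurable_pi_apply (i : ℕ)

/-- The log-likelihood ratio at time `n` of the law `Q₁` against the law `Q₀` of a stream:
the logarithm of the density ratio of the laws of the first `n` observations. -/
noncomputable def streamLLR {X : Type u} [MeasurableSpace X] (Q₀ Q₁ : Measure (ℕ → X))
    (n : ℕ) (x : ℕ → X) : ℝ :=
  llr (Q₁.map (streamPrefix n)) (Q₀.map (streamPrefix n)) (streamPrefix n x)

/-- `J` streams with, for each stream, a simple null law `P₀ j` and a simple alternative
law `P₁ j`.  The two laws are distinct, mutually absolutely continuous on every finite horizon, and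
the log-likelihood ratio tends to `-∞` under the null and to `∞` under the alternative. -/
structure StreamModel (J : ℕ) where
  Obs : Fin J → Type u
  [measObs : ∀ j, MeasurableSpace (Obs j)]
  P₀ : ∀ j, Measure (ℕ → Obs j)
  P₁ : ∀ j, Measure (ℕ → Obs j)
  [prob₀ : ∀ j, IsProbabilityMeasure (P₀ j)]
  [prob₁ : ∀ j, IsProbabilityMeasure (P₁ j)]
  distinct : ∀ j, P₀ j ≠ P₁ j
  ac₀₁ : ∀ j n, (P₀ j).map (streamPrefix n) ≪ (P₁ j).map (streamPrefix n)
  ac₁₀ : ∀ j n, (P₁ j).map (streamPrefix n) ≪ (P₀ j).map (streamPrefix n)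
  tendsto₀ : ∀ j, ∀ᵐ x ∂(P₀ j), Tendsto (fun n => streamLLR (P₀ j) (P₁ j) n x) atTop atBot
  tendsto₁ : ∀ j, ∀ᵐ x ∂(P₁ j), Tendsto (fun n => streamLLR (P₀ j) (P₁ j) n x) atTop atTop

attribute [instance] StreamModel.measObs StreamModel.prob₀ StreamModel.prob₁

namespace StreamModel

variable {J : ℕ} (M : StreamModel.{u} J)

/-- The sample space: one whole path for each stream. -/
abbrev Path : Type u := ∀ j, ℕ → M.Obs j

/-- The law of the data when `A` is the set of signals: the streams are independent, and stream `j`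
has law `P₁ j` if `j ∈ A` and `P₀ j` otherwise. -/
noncomputable def law (A : Finset (Fin J)) : Measure M.Path :=
  Measure.pi fun j => if j ∈ A then M.P₁ j else M.P₀ j

/-- The first `n` observations of all streams. -/
def history (n : ℕ) (ω : M.Path) : ∀ j, Fin n → M.Obs j := fun j => streamPrefix n (ω j)

lemma measurable_history (n : ℕ) : Measurable (M.history n) :=
  measurable_pi_lambda _ fun j => (measurable_streamPrefix n).comp (measurable_pi_apply j)

/-- The observed filtration: `filt n` is generated by the first `n` observations
of all streams. -/
def filt : Filtration ℕ (inferInstance : MeasurableSpace M.Path) where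
  seq n := MeasurableSpace.comap (M.history n) inferInstance
  mono' := by
    intro n k hnk
    have h : Measurable fun (y : ∀ j, Fin k → M.Obs j) j (i : Fin n) => y j (Fin.castLE hnk i) := by
      fun_prop
    rintro s ⟨t, ht, rfl⟩
    exact ⟨_, h ht, rfl⟩
  le' n := (M.measurable_history n).comap_le

/-- The log-likelihood ratio of stream `j` at time `n`. -/
noncomputable def lam (j : Fin J) (n : ℕ) (ω : M.Path) : ℝ :=
  streamLLR (M.P₀ j) (M.P₁ j) n (ω j)

lemma measurable_lam (j : Fin J) (n : ℕ) : Measurable[M.filt n] (M.lam j n) := by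
  have h : Measurable fun y : ∀ j, Fin n → M.Obs j =>
      llr ((M.P₁ j).map (streamPrefix n)) ((M.P₀ j).map (streamPrefix n)) (y j) :=
    (measurable_llr _ _).comp (measurable_pi_apply j)
  exact h.comp (comap_measurable (M.history n))

/-- A sequential procedure: a stopping time `T`, possibly infinite, of the observed filtration
and a decision rule `D`, the set of the streams declared signals,
measurable with respect to the stopped σ-algebra. -/
structure Procedure where
  T : M.Path → ℕ∞
  D : M.Path → Finset (Fin J)
  isStoppingTime : IsStoppingTime M.filt T
  measurable_D : ∀ j, MeasurableSet[isStoppingTime.measurableSpace] {ω | j ∈ D ω}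

/-- The expected sample size under signal set `A`. -/
noncomputable def expT (A : Finset (Fin J)) (δ : M.Procedure) : ℝ≥0∞ :=
  ∫⁻ ω, (δ.T ω : ℝ≥0∞) ∂(M.law A)

/-- Type 1 familywise error rate: at least one noise stream is declared a signal. -/
noncomputable def fwe₁ (A : Finset (Fin J)) (δ : M.Procedure) : ℝ :=
  (M.law A).real {ω | 1 ≤ (δ.D ω \ A).card}

/-- Type 2 familywise error rate: at least one signal stream is declared noise. -/
noncomputable def fwe₂ (A : Finset (Fin J)) (δ : M.Procedure) : ℝ :=
  (M.law A).real {ω | 1 ≤ (A \ δ.D ω).card}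

/-- A multiple testing error metric: for each signal set, a type 1 and a type 2 error
in `[0, 1]` of every procedure. -/
structure ErrorMetric where
  type₁ : Finset (Fin J) → M.Procedure → unitInterval
  type₂ : Finset (Fin J) → M.Procedure → unitInterval

/-- The procedures that control the metric at levels `a` and `b` on the class `S`
of signal sets. -/
def ErrorMetric.controlling {M : StreamModel.{u} J} (E : M.ErrorMetric)
    (S : Set (Finset (Fin J))) (a b : ℝ) : Set M.Procedure :=
  {δ | ∀ A ∈ S, (E.type₁ A δ : ℝ) ≤ a ∧ (E.type₂ A δ : ℝ) ≤ b}

/-! ### The gap rule -/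

/-- The streams listed by decreasing log-likelihood ratio at time `n`, ties being broken by the
index; `M.rank n ω k` is the stream with the `(k + 1)`-st largest value. -/
noncomputable def rank (n : ℕ) (ω : M.Path) : Equiv.Perm (Fin J) :=
  Tuple.sort fun j => -M.lam j n ω

/-- The difference of the `m`-th and the `(m + 1)`-st largest log-likelihood ratio at time `n`. -/
noncomputable def gap (m : ℕ) (hm : 1 ≤ m ∧ m < J) (n : ℕ) (ω : M.Path) : ℝ :=
  M.lam (M.rank n ω ⟨m - 1, (Nat.sub_le m 1).trans_lt hm.2⟩) n ω
    - M.lam (M.rank n ω ⟨m, hm.2⟩) n ω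

/-- The first time `n ≥ 1` at which the gap is at least `c`. -/
noncomputable def gapT (m : ℕ) (hm : 1 ≤ m ∧ m < J) (c : ℝ) (ω : M.Path) : ℕ∞ :=
  ⨅ (n : ℕ) (_ : 1 ≤ n ∧ c ≤ M.gap m hm n ω), (n : ℕ∞)

open Classical in
/-- The `m` streams with the largest log-likelihood ratios at the stopping time
(the empty set on the event that the rule never stops). -/
noncomputable def gapD (m : ℕ) (hm : 1 ≤ m ∧ m < J) (c : ℝ) (ω : M.Path) : Finset (Fin J) :=
  if M.gapT m hm c ω = ⊤ then ∅
  else (Finset.univ.filter fun k : Fin J => (k : ℕ) < m).image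
    (M.rank (M.gapT m hm c ω).toNat ω)

lemma measurableSet_rank_eq (n : ℕ) (σ : Equiv.Perm (Fin J)) :
    MeasurableSet[M.filt n] {ω | M.rank n ω = σ} := by
  let _ : MeasurableSpace M.Path := M.filt n
  have hl : ∀ j, Measurable (M.lam j n) := fun j => M.measurable_lam j n
  have : {ω | M.rank n ω = σ} =
      (⋂ i, ⋂ j, ⋂ (_ : i ≤ j), {ω | M.lam (σ j) n ω ≤ M.lam (σ i) n ω}) ∩
      (⋂ i, ⋂ j, ⋂ (_ : i < j), ⋂ (_ : ¬ σ i < σ j),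
        {ω | M.lam (σ i) n ω = M.lam (σ j) n ω}ᶜ) := by
    ext ω
    simp only [rank, Set.mem_ofPred_eq, Set.mem_inter_iff, Set.mem_iInter, Set.mem_compl_iff]
    rw [eq_comm, Tuple.eq_sort_iff]
    refine and_congr ⟨fun h i j hij => ?_, fun h i j hij => ?_⟩
      ⟨fun h i j hij hn he => hn (h i j hij (by rw [he])), fun h i j hij he => ?_⟩
    · simpa using h hij
    · simpa using h i j hij
    · by_contra hn
      exact h i j hij hn (neg_injective he)
  rw [this]
  refine MeasurableSet.inter ?_ ?_
  · exact .iInter fun i => .iInter fun j => .iInter fun _ => measurableSet_le (hl _) (hl _)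
  · exact .iInter fun i => .iInter fun j => .iInter fun _ => .iInter fun _ =>
      (measurableSet_eq_fun (hl _) (hl _)).compl

lemma measurableSet_gap_ge (m : ℕ) (hm : 1 ≤ m ∧ m < J) (n : ℕ) (c : ℝ) :
    MeasurableSet[M.filt n] {ω | c ≤ M.gap m hm n ω} := by
  let _ : MeasurableSpace M.Path := M.filt n
  have hl : ∀ j, Measurable (M.lam j n) := fun j => M.measurable_lam j n
  have : {ω | c ≤ M.gap m hm n ω} = ⋃ σ : Equiv.Perm (Fin J), {ω | M.rank n ω = σ} ∩
      {ω | c ≤ M.lam (σ ⟨m - 1, (Nat.sub_le m 1).trans_lt hm.2⟩) n ω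
        - M.lam (σ ⟨m, hm.2⟩) n ω} := by
    ext ω
    simp [gap]
  rw [this]
  exact .iUnion fun σ => (M.measurableSet_rank_eq n σ).inter
    (measurableSet_le measurable_const ((hl _).sub (hl _)))

lemma gapT_le_iff (m : ℕ) (hm : 1 ≤ m ∧ m < J) (c : ℝ) (n : ℕ) (ω : M.Path) :
    M.gapT m hm c ω ≤ n ↔ ∃ k ≤ n, 1 ≤ k ∧ c ≤ M.gap m hm k ω := by
  constructor
  · intro h
    have h' : M.gapT m hm c ω < ((n + 1 : ℕ) : ℕ∞) :=
      h.trans_lt (by exact_mod_cast Nat.lt_succ_self n)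
    simp only [gapT, iInf_lt_iff] at h'
    obtain ⟨k, hk, hkn⟩ := h'
    exact ⟨k, Nat.lt_succ_iff.1 (by exact_mod_cast hkn), hk⟩
  · rintro ⟨k, hkn, hk⟩
    exact (iInf₂_le k hk).trans (by exact_mod_cast hkn)

lemma isStoppingTime_gapT (m : ℕ) (hm : 1 ≤ m ∧ m < J) (c : ℝ) :
    IsStoppingTime M.filt (M.gapT m hm c) := by
  intro n
  have : {ω | M.gapT m hm c ω ≤ (n : ℕ∞)} =
      ⋃ k, ⋃ (_ : k ≤ n), ⋃ (_ : 1 ≤ k), {ω | c ≤ M.gap m hm k ω} := by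
    ext ω
    simp only [gapT_le_iff, Set.mem_ofPred_eq, Set.mem_iUnion, exists_prop]
  change MeasurableSet[M.filt n] {ω | M.gapT m hm c ω ≤ (n : ℕ∞)}
  rw [this]
  exact .iUnion fun k => .iUnion fun hk => .iUnion fun _ =>
    M.filt.mono hk _ (M.measurableSet_gap_ge m hm k c)

lemma measurable_gapD (m : ℕ) (hm : 1 ≤ m ∧ m < J) (c : ℝ) (j : Fin J) :
    MeasurableSet[(M.isStoppingTime_gapT m hm c).measurableSpace]
      {ω | j ∈ M.gapD m hm c ω} := by
  classical
  have key : ∀ k : ℕ, MeasurableSet[M.filt k]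
      {ω | M.gapT m hm c ω = k ∧ j ∈ M.gapD m hm c ω} := by
    intro k
    have : {ω | M.gapT m hm c ω = k ∧ j ∈ M.gapD m hm c ω} =
        {ω | M.gapT m hm c ω = k} ∩ ⋃ (σ : Equiv.Perm (Fin J))
          (_ : j ∈ (Finset.univ.filter fun k : Fin J => (k : ℕ) < m).image σ),
          {ω | M.rank k ω = σ} := by
      ext ω
      simp only [Set.mem_ofPred_eq, Set.mem_inter_iff, Set.mem_iUnion, exists_prop]
      refine and_congr_right fun h => ?_
      have hne : M.gapT m hm c ω ≠ ⊤ := by rw [h]; exact ENat.natCast_ne_top k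
      rw [gapD, if_neg hne, h, ENat.toNat_natCast]
      simp
    rw [this]
    exact ((M.isStoppingTime_gapT m hm c).measurableSet_eq k).inter
      (.iUnion fun σ => .iUnion fun _ => M.measurableSet_rank_eq k σ)
  refine ⟨?_, fun n => ?_⟩
  · have : {ω | j ∈ M.gapD m hm c ω} =
        ⋃ k : ℕ, {ω | M.gapT m hm c ω = k ∧ j ∈ M.gapD m hm c ω} := by
      ext ω
      simp only [Set.mem_ofPred_eq, Set.mem_iUnion]
      refine ⟨fun h => ?_, fun ⟨k, _, h⟩ => h⟩
      have hne : M.gapT m hm c ω ≠ ⊤ := by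
        intro ht
        rw [gapD, if_pos ht] at h
        simp at h
      exact ⟨(M.gapT m hm c ω).toNat, (ENat.natCast_toNat hne).symm, h⟩
    rw [this]
    exact MeasurableSet.iUnion (m := ⨆ t, M.filt t)
      fun k => le_iSup (fun t => M.filt t) k _ (key k)
  · have : {ω | j ∈ M.gapD m hm c ω} ∩ {ω | M.gapT m hm c ω ≤ (n : ℕ∞)} =
        ⋃ (k : ℕ) (_ : k ≤ n), {ω | M.gapT m hm c ω = k ∧ j ∈ M.gapD m hm c ω} := by
      ext ω
      simp only [Set.mem_inter_iff, Set.mem_ofPred_eq, Set.mem_iUnion, exists_prop]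
      constructor
      · rintro ⟨h, hT⟩
        have hne : M.gapT m hm c ω ≠ ⊤ := ne_top_of_le_ne_top (ENat.natCast_ne_top n) hT
        obtain ⟨k, hk⟩ := ENat.ne_top_iff_exists.1 hne
        refine ⟨k, ?_, hk.symm, h⟩
        rw [← hk] at hT
        exact_mod_cast hT
      · rintro ⟨k, hk, hT, h⟩
        refine ⟨h, ?_⟩
        rw [hT]
        exact_mod_cast hk
    change MeasurableSet[M.filt n] ({ω | j ∈ M.gapD m hm c ω} ∩ {ω | M.gapT m hm c ω ≤ (n : ℕ∞)})
    rw [this]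
    exact .iUnion fun k => .iUnion fun hk => M.filt.mono hk _ (key k)

/-- The gap rule with number of signals `m` and threshold `c`. -/
noncomputable def gapRule (m : ℕ) (hm : 1 ≤ m ∧ m < J) (c : ℝ) : M.Procedure where
  T := M.gapT m hm c
  D := M.gapD m hm c
  isStoppingTime := M.isStoppingTime_gapT m hm c
  measurable_D := M.measurable_gapD m hm c

/-! ### Independent and identically distributed observations, information numbers -/

/-- Under both hypotheses, every stream consists of i.i.d. observations. -/
def IsIID : Prop :=
  ∀ j, (iIndepFun (fun (n : ℕ) (x : ℕ → M.Obs j) => x n) (M.P₀ j) ∧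
      ∀ n, IdentDistrib (fun x : ℕ → M.Obs j => x n) (fun x => x 0) (M.P₀ j) (M.P₀ j)) ∧
    (iIndepFun (fun (n : ℕ) (x : ℕ → M.Obs j) => x n) (M.P₁ j) ∧
      ∀ n, IdentDistrib (fun x : ℕ → M.Obs j => x n) (fun x => x 0) (M.P₁ j) (M.P₁ j))

/-- The Kullback-Leibler information number of stream `j` under the null. -/
noncomputable def info₀ (j : Fin J) : ℝ :=
  ∫ x, -streamLLR (M.P₀ j) (M.P₁ j) 1 x ∂(M.P₀ j)

/-- The Kullback-Leibler information number of stream `j` under the alternative. -/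
noncomputable def info₁ (j : Fin J) : ℝ :=
  ∫ x, streamLLR (M.P₀ j) (M.P₁ j) 1 x ∂(M.P₁ j)

/-- All information numbers are finite. -/
def FiniteInfo : Prop :=
  ∀ j, Integrable (streamLLR (M.P₀ j) (M.P₁ j) 1) (M.P₀ j) ∧
    Integrable (streamLLR (M.P₀ j) (M.P₁ j) 1) (M.P₁ j)

/-- The variance, in `[0, ∞]`, of the log-likelihood ratio at time 1 under the null. -/
noncomputable def var₀ (j : Fin J) : ℝ≥0∞ :=
  evariance (fun x => -streamLLR (M.P₀ j) (M.P₁ j) 1 x) (M.P₀ j)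

/-- The variance, in `[0, ∞]`, of the log-likelihood ratio at time 1 under the alternative. -/
noncomputable def var₁ (j : Fin J) : ℝ≥0∞ :=
  evariance (streamLLR (M.P₀ j) (M.P₁ j) 1) (M.P₁ j)

/-- The smallest null information number among the noise streams. -/
noncomputable def eta₀ (A : Finset (Fin J)) : ℝ := ⨅ j : {j : Fin J // j ∉ A}, M.info₀ j

/-- The smallest alternative information number among the signal streams. -/
noncomputable def eta₁ (A : Finset (Fin J)) : ℝ := ⨅ j : {j : Fin J // j ∈ A}, M.info₁ j

end StreamModel

/-- The class of signal sets with exactly `m` signals. -/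
def exactClass (J m : ℕ) : Set (Finset (Fin J)) := {A | A.card = m}

/-- The threshold `|log ((a / C₁) ∧ (b / C₁))| + log (m (J - m))`. -/
noncomputable def gapThreshold (J m : ℕ) (C₁ a b : ℝ) : ℝ :=
  |Real.log (min (a / C₁) (b / C₁))| + Real.log ((m : ℝ) * ((J : ℝ) - (m : ℝ)))

/-- On the gap rules with positive threshold, the metric is at most `C₁` times the familywise
error rate. -/
def StreamModel.ErrorMetric.UpperBound {J : ℕ} {M : StreamModel.{u} J} (E : M.ErrorMetric)
    (m : ℕ) (hm : 1 ≤ m ∧ m < J) (C₁ : ℝ) : Prop :=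
  ∀ A ∈ exactClass J m, ∀ c : ℝ, 0 < c →
    (E.type₁ A (M.gapRule m hm c) : ℝ) ≤ C₁ * M.fwe₁ A (M.gapRule m hm c) ∧
    (E.type₂ A (M.gapRule m hm c) : ℝ) ≤ C₁ * M.fwe₂ A (M.gapRule m hm c)

/-- On every procedure, the metric is at least `C₂` times the familywise error rate. -/
def StreamModel.ErrorMetric.LowerBound {J : ℕ} {M : StreamModel.{u} J} (E : M.ErrorMetric)
    (m : ℕ) (C₂ : ℝ) : Prop :=
  ∀ A ∈ exactClass J m, ∀ δ : M.Procedure,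
    C₂ * M.fwe₁ A δ ≤ (E.type₁ A δ : ℝ) ∧ C₂ * M.fwe₂ A δ ≤ (E.type₂ A δ : ℝ)

/-! ### Densities of product measures -/

section ProductDensity

variable {κ : Type*} [Fintype κ] {X : κ → Type*} [∀ i, MeasurableSpace (X i)]

/-! Everything rests on one comparison. Exchanging a signal `j` for a noise stream `k` turns `A`
into another set of size `m`, and at time `n` the density of the new law with respect to `P_A` is
`exp (λ^k(n) - λ^j(n))`; this persists at finite random times (`setLLR_swap`,
`setLIntegral_exp_setLLR_stopped`).

Error control. A wrong set declared by the gap rule still has `m` elements, so it contains a noise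
stream `k` and omits a signal `j`, and `λ^k - λ^j ≥ c` at the stopping time. By the change of
measure this has probability at most `exp (-c)` for each of the `m (J - m)` pairs, and the threshold
compensates for their number and for `C₁`.

Sample size of the gap rule. The rule has stopped by time `n` once every signal is above `n (η₁ -
2ε)`, every noise stream is below `-n (η₀ - 2ε)`, and `n (η₁ + η₀ - 4ε) ≥ c`. An increment `X` of
`λ` on a signal, or of `-λ` on a noise stream, satisfies `E exp (-X) ≤ 1`. This controls the left
tail, so a Chernoff bound needs only a lower bound on the mean of `X` truncated at some level `B`
(`measureReal_sum_le_le`). Summing over streams and times adds to `c / (η₁ + η₀ - 4ε)` only a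
constant plus a multiple of `J` that depends on `ε` and `B` (`IsIID.expT_gapRule_le`).

Lower bound. Let `j` and `k` attain the two minima. Under the swapped law, declaring `A` is an error
of both types, hence has probability at most `(α ∧ β) / C₂`; under `P_A` it has probability near
one. The Gibbs variational inequality for the two laws stopped at `T`, with Wald's identity for the
log-likelihood ratio, then forces `(η₁ + η₀) E_A T` to be at least about `|log (α ∧ β)|`
(`IsIID.log_mul_law_D_eq_le`).

Both bounds are nonasymptotic, so `gapRule_isEquivalent` can compare them along any filter of
models. Its one uniformity requirement is a common truncation level: dominated convergence provides
it for a fixed model, bounded variances for varying ones. -/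

lemma lintegral_pi_prod (μ : ∀ i, Measure (X i)) [∀ i, IsProbabilityMeasure (μ i)]
    {f : ∀ i, X i → ℝ≥0∞} (hf : ∀ i, Measurable (f i)) :
    ∫⁻ x, ∏ i, f i (x i) ∂(Measure.pi μ) = ∏ i, ∫⁻ y, f i y ∂(μ i) := by
  have h := lintegral_prod_eq_prod_lintegral_of_indepFun (μ := Measure.pi μ) Finset.univ
    (fun i (x : ∀ i, X i) => f i (x i)) (iIndepFun_pi (fun i => (hf i).aemeasurable))
    (fun i => (hf i).comp (measurable_pi_apply i))
  refine h.trans (Finset.prod_congr rfl fun i _ => ?_)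
  exact (measurePreserving_eval μ i).lintegral_comp (hf i)

/-- A product measure is determined by boxes, and the indicator of a box times a product density is
again a product of functions of one coordinate. -/
lemma pi_withDensity (μ ν : ∀ i, Measure (X i)) [∀ i, IsProbabilityMeasure (μ i)]
    [∀ i, IsProbabilityMeasure (ν i)] {f : ∀ i, X i → ℝ≥0∞} (hf : ∀ i, Measurable (f i))
    (h : ∀ i, (μ i).withDensity (f i) = ν i) :
    (Measure.pi μ).withDensity (fun x => ∏ i, f i (x i)) = Measure.pi ν := by
  classical
  refine (Measure.pi_eq fun s hs => ?_).symm
  rw [withDensity_apply _ (MeasurableSet.univ_pi hs),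
    ← lintegral_indicator (MeasurableSet.univ_pi hs)]
  have : (Set.univ.pi s).indicator (fun x => ∏ i, f i (x i)) =
      fun x => ∏ i, (s i).indicator (f i) (x i) := by
    ext x
    by_cases hx : x ∈ Set.univ.pi s
    · rw [Set.indicator_of_mem hx]
      exact Finset.prod_congr rfl fun i _ => by rw [Set.indicator_of_mem (hx i trivial)]
    · rw [Set.indicator_of_notMem hx]
      obtain ⟨i, hi⟩ : ∃ i, x i ∉ s i := by simpa using hx
      exact (Finset.prod_eq_zero (Finset.mem_univ i) (Set.indicator_of_notMem hi _)).symm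
  rw [this, lintegral_pi_prod μ fun i => (hf i).indicator (hs i)]
  refine Finset.prod_congr rfl fun i _ => ?_
  rw [lintegral_indicator (hs i), ← withDensity_apply _ (hs i), h i]

lemma pi_withDensity_rnDeriv (μ ν : ∀ i, Measure (X i)) [∀ i, IsProbabilityMeasure (μ i)]
    [∀ i, IsProbabilityMeasure (ν i)] (h : ∀ i, ν i ≪ μ i) :
    (Measure.pi μ).withDensity (fun x => ∏ i, (ν i).rnDeriv (μ i) (x i)) = Measure.pi ν :=
  pi_withDensity μ ν (fun _ => Measure.measurable_rnDeriv _ _)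
    fun i => Measure.withDensity_rnDeriv_eq _ _ (h i)

lemma ae_pi_eval (μ : ∀ i, Measure (X i)) [∀ i, IsProbabilityMeasure (μ i)]
    {p : ∀ i, X i → Prop} (h : ∀ i, ∀ᵐ y ∂(μ i), p i y) :
    ∀ᵐ x ∂(Measure.pi μ), ∀ i, p i (x i) :=
  ae_all_iff.2 fun i => (measurePreserving_eval μ i).quasiMeasurePreserving.ae (h i)

/-- The log-likelihood ratio of product measures is the sum of the log-likelihood ratios. -/
lemma llr_pi (μ ν : ∀ i, Measure (X i)) [∀ i, IsProbabilityMeasure (μ i)]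
    [∀ i, IsProbabilityMeasure (ν i)] (h : ∀ i, ν i ≪ μ i) (h' : ∀ i, μ i ≪ ν i) :
    llr (Measure.pi ν) (Measure.pi μ) =ᵐ[Measure.pi μ]
      fun x => ∑ i, llr (ν i) (μ i) (x i) := by
  have hm : Measurable fun x : ∀ i, X i => ∏ i, (ν i).rnDeriv (μ i) (x i) :=
    Finset.measurable_prod _ fun i _ =>
      (Measure.measurable_rnDeriv _ _).comp (measurable_pi_apply i)
  have h1 := Measure.rnDeriv_withDensity (Measure.pi μ) hm
  rw [pi_withDensity_rnDeriv μ ν h] at h1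
  filter_upwards [h1, ae_pi_eval μ (fun i => Measure.rnDeriv_pos' (h' i)),
    ae_pi_eval μ (fun i => Measure.rnDeriv_lt_top (ν i) (μ i))] with x hx hpos hlt
  simp only [llr]
  rw [hx, ENNReal.toReal_prod, Real.log_prod]
  exact fun i _ => (ENNReal.toReal_pos (hpos i).ne' (hlt i).ne).ne'

end ProductDensity

/-! ### Change of measure -/

namespace StreamModel

variable {J : ℕ} (M : StreamModel.{u} J)

/-- The law of stream `j` when `A` is the set of signals. -/
noncomputable abbrev marg (A : Finset (Fin J)) (j : Fin J) : Measure (ℕ → M.Obs j) :=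
  if j ∈ A then M.P₁ j else M.P₀ j

instance (A : Finset (Fin J)) (j : Fin J) : IsProbabilityMeasure (M.marg A j) := by
  unfold marg; split_ifs <;> infer_instance

instance (A : Finset (Fin J)) : IsProbabilityMeasure (M.law A) :=
  inferInstanceAs (IsProbabilityMeasure (Measure.pi fun j => M.marg A j))

instance isProbabilityMeasure_map_streamPrefix {X : Type*} [MeasurableSpace X]
    (Q : Measure (ℕ → X)) [IsProbabilityMeasure Q] (n : ℕ) :
    IsProbabilityMeasure (Q.map (streamPrefix n)) :=
  Measure.isProbabilityMeasure_map (measurable_streamPrefix n).aemeasurable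

lemma measurePreserving_eval_law (A : Finset (Fin J)) (j : Fin J) :
    MeasurePreserving (fun ω : M.Path => ω j) (M.law A) (M.marg A j) :=
  measurePreserving_eval (M.marg A) j

lemma ae_law_of_marg (A : Finset (Fin J)) (j : Fin J) {p : (ℕ → M.Obs j) → Prop}
    (h : ∀ᵐ x ∂(M.marg A j), p x) : ∀ᵐ ω ∂(M.law A), p (ω j) :=
  (M.measurePreserving_eval_law A j).quasiMeasurePreserving.ae h

lemma map_history_law (A : Finset (Fin J)) (n : ℕ) :
    (M.law A).map (M.history n) = Measure.pi fun j => (M.marg A j).map (streamPrefix n) :=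
  (Measure.pi_map_pi (μ := M.marg A) (f := fun _ => streamPrefix n)
    fun _ => (measurable_streamPrefix n).aemeasurable)

/-- The log-likelihood ratio at time `n` of the signal set `B` against the signal set `A`. -/
noncomputable def setLLR (A B : Finset (Fin J)) (n : ℕ) (ω : M.Path) : ℝ :=
  ∑ j, ((if j ∈ B then M.lam j n ω else 0) - if j ∈ A then M.lam j n ω else 0)

/-- All four combinations of marginals are expressed through the single ratio of `P₁` to `P₀`: it
appears as it is when `j` enters the signal set, inverted when `j` leaves it, and not at all
otherwise. -/
lemma rnDeriv_marg_ae_eq (A B : Finset (Fin J)) (n : ℕ) (j : Fin J) :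
    ∀ᵐ y ∂((M.marg A j).map (streamPrefix n)),
      ((M.marg B j).map (streamPrefix n)).rnDeriv ((M.marg A j).map (streamPrefix n)) y =
      ENNReal.ofReal (Real.exp
        ((if j ∈ B then llr ((M.P₁ j).map (streamPrefix n)) ((M.P₀ j).map (streamPrefix n)) y
          else 0) -
        if j ∈ A then llr ((M.P₁ j).map (streamPrefix n)) ((M.P₀ j).map (streamPrefix n)) y
          else 0)) := by
  unfold marg
  by_cases hB : j ∈ B <;> by_cases hA : j ∈ A
  · simp only [hA, hB, if_true, sub_self, Real.exp_zero, ENNReal.ofReal_one]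
    exact Measure.rnDeriv_self _
  · simp only [hA, hB, if_true, if_false, sub_zero]
    filter_upwards [exp_llr_of_ac' _ _ (M.ac₀₁ j n),
      Measure.rnDeriv_lt_top ((M.P₁ j).map (streamPrefix n)) ((M.P₀ j).map (streamPrefix n))]
      with y hy hlt
    rw [hy, ENNReal.ofReal_toReal hlt.ne]
  · simp only [hA, hB, if_true, if_false, zero_sub]
    filter_upwards [exp_neg_llr (M.ac₁₀ j n),
      Measure.rnDeriv_lt_top ((M.P₀ j).map (streamPrefix n)) ((M.P₁ j).map (streamPrefix n))]
      with y hy hlt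
    rw [hy, ENNReal.ofReal_toReal hlt.ne]
  · simp only [hA, hB, if_false, sub_self, Real.exp_zero, ENNReal.ofReal_one]
    exact Measure.rnDeriv_self _

lemma map_marg_ac (A B : Finset (Fin J)) (n : ℕ) (j : Fin J) :
    (M.marg B j).map (streamPrefix n) ≪ (M.marg A j).map (streamPrefix n) := by
  unfold marg
  split_ifs
  exacts [.rfl, M.ac₁₀ j n, M.ac₀₁ j n, .rfl]

/-- Change of measure on a finite horizon. -/
lemma setLIntegral_exp_setLLR (A B : Finset (Fin J)) (n : ℕ) {H : Set M.Path}
    (hH : MeasurableSet[M.filt n] H) :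
    ∫⁻ ω in H, ENNReal.ofReal (Real.exp (M.setLLR A B n ω)) ∂(M.law A) = M.law B H := by
  obtain ⟨t, ht, rfl⟩ := hH
  -- Laws of whole paths for different signal sets are mutually singular, so the density exists only
  -- for the history up to `n`; this is why `H` must be decided at time `n`.
  let g : (∀ j, Fin n → M.Obs j) → ℝ≥0∞ := fun y => ∏ j,
    ((M.marg B j).map (streamPrefix n)).rnDeriv ((M.marg A j).map (streamPrefix n)) (y j)
  have hg : Measurable g := Finset.measurable_prod _ fun i _ =>
      (Measure.measurable_rnDeriv _ _).comp (measurable_pi_apply i)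
  have hwd := pi_withDensity_rnDeriv (fun j => (M.marg A j).map (streamPrefix n))
    (fun j => (M.marg B j).map (streamPrefix n)) (fun j => M.map_marg_ac A B n j)
  rw [← map_history_law, ← map_history_law] at hwd
  have hae : ∀ᵐ ω ∂(M.law A),
      ENNReal.ofReal (Real.exp (M.setLLR A B n ω)) = g (M.history n ω) := by
    have h1 := ae_pi_eval _ (fun j => M.rnDeriv_marg_ae_eq A B n j)
    rw [← map_history_law] at h1
    filter_upwards [ae_of_ae_map (M.measurable_history n).aemeasurable h1] with ω hω
    simp only [g, hω]
    rw [← ENNReal.ofReal_prod_of_nonneg (fun _ _ => (Real.exp_pos _).le), ← Real.exp_sum]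
    rfl
  rw [lintegral_congr_ae (ae_restrict_of_ae hae),
    ← setLIntegral_map ht hg (M.measurable_history n), ← withDensity_apply _ ht, hwd,
    Measure.map_apply (M.measurable_history n) ht]

/-- Change of measure at a finite random time. -/
lemma setLIntegral_exp_setLLR_stopped (A B : Finset (Fin J)) (τ : M.Path → ℕ) {H : Set M.Path}
    (hH : ∀ n, MeasurableSet[M.filt n] (H ∩ {ω | τ ω = n})) :
    ∫⁻ ω in H, ENNReal.ofReal (Real.exp (M.setLLR A B (τ ω) ω)) ∂(M.law A) = M.law B H := by
  -- Slicing by the value of `τ` reduces to a fixed horizon on each slice.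
  have hU : H = ⋃ n, H ∩ {ω | τ ω = n} := by ext ω; simp
  have hmeas : ∀ n, MeasurableSet (H ∩ {ω | τ ω = n}) := fun n => M.filt.le n _ (hH n)
  have hdisj : Pairwise (Function.onFun Disjoint fun n => H ∩ {ω | τ ω = n}) := by
    intro a b hab
    refine Set.disjoint_left.2 fun ω ha hb => hab ?_
    rw [← ha.2, ← hb.2]
  rw [hU, lintegral_iUnion hmeas hdisj, measure_iUnion hdisj hmeas]
  refine tsum_congr fun n => ?_
  rw [← M.setLIntegral_exp_setLLR A B n (hH n)]
  refine setLIntegral_congr_fun (hmeas n) fun ω hω => ?_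
  simp only [show τ ω = n from hω.2]

/-- Exchanging one signal for one noise stream. -/
lemma setLLR_swap {A : Finset (Fin J)} {j k : Fin J} (hj : j ∈ A) (hk : k ∉ A) (n : ℕ)
    (ω : M.Path) :
    M.setLLR A (insert k (A.erase j)) n ω = -(M.lam j n ω - M.lam k n ω) := by
  have hjk : j ≠ k := fun h => hk (h ▸ hj)
  have : ∀ l, ((if l ∈ insert k (A.erase j) then M.lam l n ω else 0) -
      if l ∈ A then M.lam l n ω else 0) =
      (if l = k then M.lam l n ω else 0) - if l = j then M.lam l n ω else 0 := by
    intro l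
    by_cases h1 : l = k
    · subst h1; simp [hk, hjk.symm]
    · by_cases h2 : l = j
      · subst h2; simp [hj, hjk]
      · simp [h1, h2]
  simp only [setLLR, this, Finset.sum_sub_distrib, Finset.sum_ite_eq', Finset.mem_univ, if_true]
  ring

lemma card_swap {A : Finset (Fin J)} {j k : Fin J} (hj : j ∈ A) (hk : k ∉ A) :
    (insert k (A.erase j)).card = A.card := by
  rw [Finset.card_insert_of_notMem (by simp [hk]), Finset.card_erase_add_one hj]

end StreamModel

namespace StreamModel

variable {J : ℕ} (M : StreamModel.{u} J)

/-! ### The gap rule: ordering, termination, error control -/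

lemma lam_rank_antitone (n : ℕ) (ω : M.Path) {i k : Fin J} (h : i ≤ k) :
    M.lam (M.rank n ω k) n ω ≤ M.lam (M.rank n ω i) n ω := by
  have := Tuple.monotone_sort (fun j => -M.lam j n ω) h
  simpa [rank] using this

/-- The streams with the `m` largest log-likelihood ratios at time `n`. -/
noncomputable def topSet (m n : ℕ) (ω : M.Path) : Finset (Fin J) := by
  classical exact (Finset.univ.filter fun k : Fin J => (k : ℕ) < m).image (M.rank n ω)

lemma mem_topSet {m n : ℕ} {ω : M.Path} {j : Fin J} :
    j ∈ M.topSet m n ω ↔ ∃ i : Fin J, (i : ℕ) < m ∧ M.rank n ω i = j := by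
  simp [topSet]

lemma card_topSet {m : ℕ} (hm : 1 ≤ m ∧ m < J) (n : ℕ) (ω : M.Path) :
    (M.topSet m n ω).card = m := by
  classical
  rw [topSet, Finset.card_image_of_injective _ (M.rank n ω).injective]
  have : (Finset.univ.filter fun k : Fin J => (k : ℕ) < m) = Finset.Iio ⟨m, hm.2⟩ := by
    ext k; simp [Fin.lt_def]
  rw [this, Fin.card_Iio]

/-- The streams in the top set exceed all others by at least the gap. -/
lemma gap_le_of_mem_topSet {m : ℕ} (hm : 1 ≤ m ∧ m < J) {n : ℕ} {ω : M.Path} {k j : Fin J}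
    (hk : k ∈ M.topSet m n ω) (hj : j ∉ M.topSet m n ω) :
    M.gap m hm n ω ≤ M.lam k n ω - M.lam j n ω := by
  obtain ⟨i, hi, rfl⟩ := M.mem_topSet.1 hk
  obtain ⟨i', rfl⟩ := (M.rank n ω).surjective j
  have hi' : m ≤ i' := by
    by_contra h
    exact hj (M.mem_topSet.2 ⟨i', not_le.1 h, rfl⟩)
  have h1 := M.lam_rank_antitone n ω
    (show i ≤ ⟨m - 1, (Nat.sub_le m 1).trans_lt hm.2⟩ from Fin.le_def.2 (by simp; omega))
  have h2 := M.lam_rank_antitone n ω (show (⟨m, hm.2⟩ : Fin J) ≤ i' from Fin.le_def.2 hi')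
  rw [gap]
  linarith

/-- If all signals exceed all noise streams by `c > 0`, then so does the gap. -/
lemma le_gap {m : ℕ} (hm : 1 ≤ m ∧ m < J) {n : ℕ} {ω : M.Path} {A : Finset (Fin J)}
    (hA : A.card = m) {c : ℝ} (hc : 0 < c)
    (h : ∀ j ∈ A, ∀ k ∉ A, c ≤ M.lam j n ω - M.lam k n ω) : c ≤ M.gap m hm n ω := by
  have hgap : 0 ≤ M.gap m hm n ω :=
    sub_nonneg.2 (M.lam_rank_antitone n ω (Fin.le_def.2 (by simp)))
  have hcard := M.card_topSet hm n ω
  -- Two different sets of size `m` each have an element outside the other. The ordering would then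
  -- put a noise stream at or above a signal, against `c > 0`.
  have hEq : M.topSet m n ω = A := by
    by_contra hne
    have h1 : ¬ M.topSet m n ω ⊆ A := fun hs =>
      hne (Finset.eq_of_subset_of_card_le hs (by rw [hA, hcard]))
    have h2 : ¬ A ⊆ M.topSet m n ω := fun hs =>
      hne (Finset.eq_of_subset_of_card_le hs (by rw [hA, hcard])).symm
    obtain ⟨d, hd, hdA⟩ := Finset.not_subset.1 h1
    obtain ⟨a, ha, had⟩ := Finset.not_subset.1 h2
    linarith [h a ha d hdA, M.gap_le_of_mem_topSet hm hd had]
  refine h _ ?_ _ ?_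
  · rw [← hEq, mem_topSet]
    exact ⟨_, by simp; omega, rfl⟩
  · rw [← hEq, mem_topSet]
    rintro ⟨i, hi, he⟩
    rw [(M.rank n ω).injective he] at hi
    simp at hi

lemma gapD_eq_topSet {m : ℕ} (hm : 1 ≤ m ∧ m < J) {c : ℝ} {ω : M.Path}
    (h : M.gapT m hm c ω ≠ ⊤) :
    M.gapD m hm c ω = M.topSet m (M.gapT m hm c ω).toNat ω := by
  rw [gapD, if_neg h, topSet]

/-- A finite infimum of a set of times is attained, so the gap has reached `c` at the stopping time
itself. -/
lemma le_gap_gapT {m : ℕ} (hm : 1 ≤ m ∧ m < J) {c : ℝ} {ω : M.Path}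
    (h : M.gapT m hm c ω ≠ ⊤) : c ≤ M.gap m hm (M.gapT m hm c ω).toNat ω := by
  obtain ⟨n, hn⟩ := ENat.ne_top_iff_exists.1 h
  obtain ⟨k, hkn, hk1, hk⟩ := (M.gapT_le_iff m hm c n ω).1 hn.symm.le
  have h2 : M.gapT m hm c ω ≤ k := (M.gapT_le_iff m hm c k ω).2 ⟨k, le_rfl, hk1, hk⟩
  rw [← hn] at h2 ⊢
  have h3 : n = k := le_antisymm (by exact_mod_cast h2) hkn
  rw [ENat.toNat_natCast, h3]
  exact hk

lemma ae_tendsto_lam (A : Finset (Fin J)) : ∀ᵐ ω ∂(M.law A), ∀ j,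
    (j ∈ A → Tendsto (fun n => M.lam j n ω) atTop atTop) ∧
    (j ∉ A → Tendsto (fun n => M.lam j n ω) atTop atBot) := by
  refine ae_all_iff.2 fun j => ?_
  by_cases hj : j ∈ A
  · filter_upwards [M.ae_law_of_marg A j (p := fun x =>
      Tendsto (fun n => streamLLR (M.P₀ j) (M.P₁ j) n x) atTop atTop)
      (by simpa [marg, hj] using M.tendsto₁ j)] with ω hω
    exact ⟨fun _ => hω, fun h => absurd hj h⟩
  · filter_upwards [M.ae_law_of_marg A j (p := fun x =>
      Tendsto (fun n => streamLLR (M.P₀ j) (M.P₁ j) n x) atTop atBot)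
      (by simpa [marg, hj] using M.tendsto₀ j)] with ω hω
    exact ⟨fun h => absurd h hj, fun _ => hω⟩

/-- Almost surely all signals are eventually above `c` and all noise streams below `0`, which forces
the gap to reach `c`. -/
lemma ae_gapT_ne_top {m : ℕ} (hm : 1 ≤ m ∧ m < J) {A : Finset (Fin J)} (hA : A.card = m)
    {c : ℝ} (hc : 0 < c) : ∀ᵐ ω ∂(M.law A), M.gapT m hm c ω ≠ ⊤ := by
  filter_upwards [M.ae_tendsto_lam A] with ω hω
  have h1 : ∀ᶠ n in atTop, ∀ j, (j ∈ A → c ≤ M.lam j n ω) ∧ (j ∉ A → M.lam j n ω ≤ 0) := by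
    refine eventually_all.2 fun j => ?_
    by_cases hj : j ∈ A
    · filter_upwards [((hω j).1 hj).eventually_ge_atTop c] with n hn
      exact ⟨fun _ => hn, fun h => absurd hj h⟩
    · filter_upwards [((hω j).2 hj).eventually_le_atBot 0] with n hn
      exact ⟨fun h => absurd h hj, fun _ => hn⟩
  obtain ⟨n, hn, hn1⟩ := (h1.and (eventually_ge_atTop 1)).exists
  refine ne_top_of_le_ne_top (ENat.natCast_ne_top n)
    ((M.gapT_le_iff m hm c n ω).2 ⟨n, le_rfl, hn1, M.le_gap hm hA hc fun j hj k hk => ?_⟩)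
  linarith [(hn j).1 hj, (hn k).2 hk]

/-- The event that the gap rule stops when the noise stream `k` exceeds the signal `j`
by the threshold. -/
lemma law_gapT_reversed_le {m : ℕ} (hm : 1 ≤ m ∧ m < J) {A : Finset (Fin J)} {j k : Fin J}
    (hj : j ∈ A) (hk : k ∉ A) (c : ℝ) :
    M.law A {ω | M.gapT m hm c ω ≠ ⊤ ∧
      c ≤ M.lam k (M.gapT m hm c ω).toNat ω - M.lam j (M.gapT m hm c ω).toNat ω} ≤
      ENNReal.ofReal (Real.exp (-c)) := by
  set τ : M.Path → ℕ := fun ω => (M.gapT m hm c ω).toNat with hτ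
  set H : Set M.Path := {ω | M.gapT m hm c ω ≠ ⊤ ∧ c ≤ M.lam k (τ ω) ω - M.lam j (τ ω) ω}
  have hH : ∀ n, MeasurableSet[M.filt n] (H ∩ {ω | τ ω = n}) := by
    intro n
    have : H ∩ {ω | τ ω = n} = {ω | M.gapT m hm c ω = n} ∩
        {ω | c ≤ M.lam k n ω - M.lam j n ω} := by
      ext ω
      simp only [H, Set.mem_inter_iff, Set.mem_ofPred_eq]
      constructor
      · rintro ⟨⟨h1, h2⟩, h3⟩
        rw [h3] at h2
        refine ⟨?_, h2⟩
        rw [← h3, hτ, ENat.natCast_toNat h1]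
      · rintro ⟨h1, h2⟩
        have h3 : τ ω = n := by simp [hτ, h1]
        rw [h3, h1]
        exact ⟨⟨ENat.natCast_ne_top n, h2⟩, rfl⟩
    rw [this]
    refine ((M.isStoppingTime_gapT m hm c).measurableSet_eq n).inter ?_
    let _ : MeasurableSpace M.Path := M.filt n
    exact measurableSet_le measurable_const ((M.measurable_lam k n).sub (M.measurable_lam j n))
  have hHm : MeasurableSet H := by
    have : H = ⋃ n, H ∩ {ω | τ ω = n} := by ext ω; simp
    rw [this]
    exact .iUnion fun n => M.filt.le n _ (hH n)
  have h1 := M.setLIntegral_exp_setLLR_stopped A (insert k (A.erase j)) τ hH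
  -- On `H` the density of the swapped law with respect to `P_A` is at least `exp c`, while its
  -- integral over `H` is a probability.
  have h2 : ENNReal.ofReal (Real.exp c) * M.law A H ≤ 1 := by
    calc ENNReal.ofReal (Real.exp c) * M.law A H
        = ∫⁻ _ in H, ENNReal.ofReal (Real.exp c) ∂(M.law A) := by rw [setLIntegral_const]
      _ ≤ _ := by
        refine setLIntegral_mono' hHm fun ω hω => ?_
        refine ENNReal.ofReal_le_ofReal (Real.exp_le_exp.2 ?_)
        rw [M.setLLR_swap hj hk]
        linarith [hω.2]
      _ = _ := h1
      _ ≤ 1 := prob_le_one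
  rw [Real.exp_neg, ENNReal.ofReal_inv_of_pos (Real.exp_pos c)]
  rw [mul_comm] at h2
  exact (ENNReal.le_inv_iff_mul_le).2 h2

/-- The probability that the gap rule misidentifies the signal set. -/
lemma law_gapD_ne_le {m : ℕ} (hm : 1 ≤ m ∧ m < J) {A : Finset (Fin J)} (hA : A.card = m)
    {c : ℝ} (hc : 0 < c) :
    M.law A {ω | M.gapD m hm c ω ≠ A} ≤
      ENNReal.ofReal ((m : ℝ) * ((J : ℝ) - m) * Real.exp (-c)) := by
  have hsub : {ω | M.gapD m hm c ω ≠ A} ≤ᵐ[M.law A] ⋃ p ∈ A ×ˢ Aᶜ,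
      {ω | M.gapT m hm c ω ≠ ⊤ ∧
        c ≤ M.lam p.2 (M.gapT m hm c ω).toNat ω - M.lam p.1 (M.gapT m hm c ω).toNat ω} := by
    filter_upwards [M.ae_gapT_ne_top hm hA hc] with ω hω hne
    change M.gapD m hm c ω ≠ A at hne
    rw [M.gapD_eq_topSet hm hω] at hne
    have hcard := M.card_topSet hm (M.gapT m hm c ω).toNat ω
    -- Equal cardinalities again: a wrong decision produces a reversed pair of a signal left out and
    -- a noise stream let in, separated by at least the gap.
    have h1 : ¬ M.topSet m (M.gapT m hm c ω).toNat ω ⊆ A := fun hs =>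
      hne (Finset.eq_of_subset_of_card_le hs (by rw [hA, hcard]))
    have h2 : ¬ A ⊆ M.topSet m (M.gapT m hm c ω).toNat ω := fun hs =>
      hne (Finset.eq_of_subset_of_card_le hs (by rw [hA, hcard])).symm
    obtain ⟨d, hd, hdA⟩ := Finset.not_subset.1 h1
    obtain ⟨a, ha, had⟩ := Finset.not_subset.1 h2
    refine Set.mem_iUnion₂.2 ⟨(a, d), by simp [ha, hdA], hω, ?_⟩
    exact (M.le_gap_gapT hm hω).trans (M.gap_le_of_mem_topSet hm hd had)
  refine (measure_mono_ae hsub).trans ((measure_biUnion_finset_le _ _).trans ?_)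
  have hmJ : (0 : ℝ) ≤ (J : ℝ) - m := by
    have : (m : ℝ) < J := by exact_mod_cast hm.2
    linarith
  calc _ ≤ ∑ _p ∈ A ×ˢ Aᶜ, ENNReal.ofReal (Real.exp (-c)) := by
        refine Finset.sum_le_sum fun p hp => ?_
        rw [Finset.mem_product, Finset.mem_compl] at hp
        exact M.law_gapT_reversed_le hm hp.1 hp.2 c
    _ = _ := by
        rw [Finset.sum_const, Finset.card_product, Finset.card_compl, Fintype.card_fin, hA,
          nsmul_eq_mul, ENNReal.ofReal_mul (by positivity),
          ENNReal.ofReal_mul (Nat.cast_nonneg m), ← Nat.cast_sub hm.2.le,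
          ENNReal.ofReal_natCast, ENNReal.ofReal_natCast]
        push_cast
        rfl

/-- The term `log (m (J - m))` cancels the number of pairs and the division by `C₁` cancels the
constant of the metric. The absolute value can only raise the threshold, so no smallness of the
levels is needed. -/
lemma exp_neg_gapThreshold_le {m : ℕ} (hm : 1 ≤ m ∧ m < J) {C₁ a b : ℝ} (hC : 0 < C₁)
    (ha : 0 < a) (hb : 0 < b) :
    C₁ * ((m : ℝ) * ((J : ℝ) - m) * Real.exp (-gapThreshold J m C₁ a b)) ≤ min a b := by
  have hm0 : (0 : ℝ) < m := by exact_mod_cast hm.1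
  have hmJ : (0 : ℝ) < (J : ℝ) - m := by
    have : (m : ℝ) < J := by exact_mod_cast hm.2
    linarith
  have hx : 0 < min (a / C₁) (b / C₁) := lt_min (div_pos ha hC) (div_pos hb hC)
  have h1 : Real.exp (-|Real.log (min (a / C₁) (b / C₁))|) ≤ min (a / C₁) (b / C₁) := by
    conv_rhs => rw [← Real.exp_log hx]
    exact Real.exp_le_exp.2 (by linarith [neg_abs_le (Real.log (min (a / C₁) (b / C₁)))])
  rw [gapThreshold, neg_add, Real.exp_add, Real.exp_neg (Real.log _),
    Real.exp_log (mul_pos hm0 hmJ)]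
  rw [min_div_div_right hC.le] at h1 ⊢
  calc _ = C₁ * Real.exp (-|Real.log (min a b / C₁)|) := by field_simp
    _ ≤ C₁ * (min a b / C₁) := by gcongr
    _ = min a b := by field_simp

/-- The gap rule controls the error metric. -/
lemma gapRule_mem_controlling {m : ℕ} (hm : 1 ≤ m ∧ m < J) {E : M.ErrorMetric} {C₁ : ℝ}
    (hC : 0 < C₁) (hE : E.UpperBound m hm C₁) {a b : ℝ} (ha : 0 < a) (hb : 0 < b)
    (hc : 0 < gapThreshold J m C₁ a b) :
    M.gapRule m hm (gapThreshold J m C₁ a b) ∈ E.controlling (exactClass J m) a b := by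
  intro A hA
  set c := gapThreshold J m C₁ a b with hcdef
  have hkey := M.law_gapD_ne_le hm hA hc
  have hbd : C₁ * ((m : ℝ) * ((J : ℝ) - m) * Real.exp (-c)) ≤ min a b :=
    exp_neg_gapThreshold_le hm hC ha hb
  have hnn : 0 ≤ (m : ℝ) * ((J : ℝ) - m) * Real.exp (-c) := by
    have : (m : ℝ) < J := by exact_mod_cast hm.2
    have : (0 : ℝ) ≤ (J : ℝ) - m := by linarith
    positivity
  -- Errors of both types are contained in the event of a wrong decision, so a single bound serves
  -- both levels.
  have hfwe : ∀ S : Set M.Path, S ⊆ {ω | M.gapD m hm c ω ≠ A} →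
      C₁ * (M.law A).real S ≤ min a b := by
    intro S hS
    refine le_trans ?_ hbd
    gcongr
    exact ENNReal.toReal_le_of_le_ofReal hnn ((measure_mono hS).trans hkey)
  obtain ⟨h1, h2⟩ := hE A hA c hc
  constructor
  · refine h1.trans ((hfwe _ fun ω hω he => ?_).trans (min_le_left _ _))
    change 1 ≤ (M.gapD m hm c ω \ A).card at hω
    rw [he] at hω
    simp at hω
  · refine h2.trans ((hfwe _ fun ω hω he => ?_).trans (min_le_right _ _))
    change 1 ≤ (A \ M.gapD m hm c ω).card at hω
    rw [he] at hω
    simp at hω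

end StreamModel

/-! ### A lower deviation bound for sums of i.i.d. variables -/

/-- For `x ≥ 0` one may replace `x` by `min x B`, which lies in `[0, B]`, and expand to second
order. For `x < 0` the second-order remainder is dominated by `exp (-x)`, half of whose exponent
absorbs `x ^ 2` and the other half `exp (-θ x)`; hence `θ ≤ 1 / 2`. -/
lemma exp_neg_mul_le_truncated {θ B x : ℝ} (hθ : 0 ≤ θ) (hθ' : θ ≤ 1 / 2) (hB : 0 ≤ B) :
    Real.exp (-(θ * x)) ≤ 1 - θ * min x B + θ ^ 2 * (B ^ 2 + 8 * Real.exp (-x)) := by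
  rcases le_or_gt 0 x with hx | hx
  · have hm : 0 ≤ min x B := le_min hx hB
    have hmB : min x B ≤ B := min_le_right _ _
    set y := θ * min x B with hy
    have hy0 : 0 ≤ y := mul_nonneg hθ hm
    have h1 : Real.exp (-(θ * x)) ≤ Real.exp (-y) :=
      Real.exp_le_exp.2 (neg_le_neg (mul_le_mul_of_nonneg_left (min_le_left _ _) hθ))
    -- Since `(1 + y) (1 - y + y ^ 2) = 1 + y ^ 3 ≥ 1`, the reciprocal of the right side is at most
    -- `1 + y ≤ exp y`.
    have h2 : Real.exp (-y) ≤ 1 - y + y ^ 2 := by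
      rw [Real.exp_neg]
      refine inv_le_of_inv_le₀ (by nlinarith) ((inv_le_of_inv_le₀ (by linarith) ?_).trans
        (Real.add_one_le_exp y))
      rw [inv_le_iff_one_le_mul₀ (by linarith)]
      nlinarith [pow_nonneg hy0 3]
    have h3 : y ^ 2 ≤ θ ^ 2 * B ^ 2 := by
      rw [← mul_pow]
      exact pow_le_pow_left₀ hy0 (mul_le_mul_of_nonneg_left hmB hθ) 2
    have h4 : 0 ≤ θ ^ 2 * (8 * Real.exp (-x)) := by positivity
    linarith
  · rw [min_eq_left (hx.le.trans hB)]
    set y := -x with hy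
    have hy0 : 0 < y := neg_pos.2 hx
    set w := θ * y with hw
    have hw0 : 0 ≤ w := mul_nonneg hθ hy0.le
    have h1 : Real.exp w - 1 ≤ w * Real.exp w := by
      have := Real.add_one_le_exp (-w)
      have h2 := mul_le_mul_of_nonneg_right this (Real.exp_pos w).le
      rw [← Real.exp_add, neg_add_cancel, Real.exp_zero] at h2
      linarith
    have h2 : Real.exp w ≤ 1 + w + w ^ 2 * Real.exp w := by nlinarith
    have h3 : Real.exp w ≤ Real.exp (y / 2) := Real.exp_le_exp.2 (by nlinarith)
    have h4 : y ^ 2 ≤ 8 * Real.exp (y / 2) := by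
      have := Real.quadratic_le_exp_of_nonneg (x := y / 2) (by linarith)
      nlinarith
    have h5 : y ^ 2 * Real.exp w ≤ 8 * Real.exp y := by
      calc y ^ 2 * Real.exp w ≤ 8 * Real.exp (y / 2) * Real.exp (y / 2) := by gcongr
        _ = 8 * Real.exp y := by rw [mul_assoc, ← Real.exp_add, add_halves]
    have h6 : w ^ 2 * Real.exp w ≤ θ ^ 2 * (8 * Real.exp y) := by
      rw [hw, mul_pow, mul_assoc, ← hw]
      exact mul_le_mul_of_nonneg_left h5 (sq_nonneg θ)
    have h7 : 0 ≤ θ ^ 2 * B ^ 2 := by positivity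
    have h8 : -(θ * x) = w := by rw [hw, hy]; ring
    rw [h8]
    have h9 : θ * x = -w := by linarith
    rw [h9]
    linarith

section LowerDeviation

variable {Ω : Type*} [MeasurableSpace Ω] {P : Measure Ω}

lemma integrable_exp_neg_of_lintegral_le_one {X : Ω → ℝ} (hX : Measurable X)
    (h : ∫⁻ ω, ENNReal.ofReal (Real.exp (-X ω)) ∂P ≤ 1) :
    Integrable (fun ω => Real.exp (-X ω)) P := by
  refine ⟨by fun_prop, ?_⟩
  rw [hasFiniteIntegral_iff_ofReal (ae_of_all _ fun _ => (Real.exp_pos _).le)]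
  exact h.trans_lt ENNReal.one_lt_top

lemma integral_exp_neg_le_one {X : Ω → ℝ} (hX : Measurable X)
    (h : ∫⁻ ω, ENNReal.ofReal (Real.exp (-X ω)) ∂P ≤ 1) :
    ∫ ω, Real.exp (-X ω) ∂P ≤ 1 := by
  rw [integral_eq_lintegral_of_nonneg_ae (ae_of_all _ fun _ => (Real.exp_pos _).le) (by fun_prop)]
  exact ENNReal.toReal_le_of_le_ofReal zero_le_one (by simpa using h)

/-- The left tail is dominated by `exp (-X)` and the right one is cut off at `B`, so `X` itself need
not be integrable. -/
lemma integrable_min_const [IsProbabilityMeasure P] {X : Ω → ℝ} (hX : Measurable X)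
    (h : ∫⁻ ω, ENNReal.ofReal (Real.exp (-X ω)) ∂P ≤ 1) {B : ℝ} (hB : 0 ≤ B) :
    Integrable (fun ω => min (X ω) B) P := by
  refine ((integrable_exp_neg_of_lintegral_le_one hX h).add (integrable_const B)).mono'
    (by fun_prop) (ae_of_all _ fun ω => ?_)
  have := Real.add_one_le_exp (-X ω)
  have h0 := Real.exp_pos (-X ω)
  rw [Real.norm_eq_abs, abs_le]
  simp only [Pi.add_apply]
  constructor
  · rcases min_cases (X ω) B with h | h <;> linarith
  · linarith [min_le_right (X ω) B]

/-- Integration of the pointwise bound: `E exp (-X) ≤ 1` turns the left-tail term into the constant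
`8`, and `1 + x ≤ exp x` puts the result in a form whose powers are easy to take. -/
lemma mgf_neg_le [IsProbabilityMeasure P] {X : Ω → ℝ} (hX : Measurable X)
    (h : ∫⁻ ω, ENNReal.ofReal (Real.exp (-X ω)) ∂P ≤ 1) {B θ : ℝ} (hB : 0 ≤ B)
    (hθ : 0 ≤ θ) (hθ' : θ ≤ 1 / 2) :
    mgf X P (-θ) ≤ Real.exp (-(θ * ∫ ω, min (X ω) B ∂P) + θ ^ 2 * (B ^ 2 + 8)) := by
  have hmin := integrable_min_const hX h hB
  have hexp := integrable_exp_neg_of_lintegral_le_one hX h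
  have hi : Integrable (fun ω => 1 - θ * min (X ω) B +
      θ ^ 2 * (B ^ 2 + 8 * Real.exp (-X ω))) P :=
    ((integrable_const 1).sub (hmin.const_mul θ)).add
      (((integrable_const _).add (hexp.const_mul 8)).const_mul _)
  calc mgf X P (-θ) ≤ ∫ ω, (1 - θ * min (X ω) B +
        θ ^ 2 * (B ^ 2 + 8 * Real.exp (-X ω))) ∂P := by
        refine integral_mono_of_nonneg (ae_of_all _ fun _ => (Real.exp_pos _).le) hi
          (ae_of_all _ fun ω => ?_)
        simp only [neg_mul]
        exact exp_neg_mul_le_truncated hθ hθ' hB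
    _ = 1 - θ * ∫ ω, min (X ω) B ∂P + θ ^ 2 * (B ^ 2 + 8 * ∫ ω, Real.exp (-X ω) ∂P) := by
        have h1 : Integrable (fun ω => 1 - θ * min (X ω) B) P :=
          (integrable_const 1).sub (hmin.const_mul θ)
        have h2 : Integrable (fun ω => B ^ 2 + 8 * Real.exp (-X ω)) P :=
          (integrable_const _).add (hexp.const_mul 8)
        rw [integral_add h1 (h2.const_mul _),
          integral_sub (integrable_const 1) (hmin.const_mul θ), integral_const_mul,
          integral_const_mul, integral_add (integrable_const _) (hexp.const_mul 8),
          integral_const_mul]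
        simp
    _ ≤ -(θ * ∫ ω, min (X ω) B ∂P) + θ ^ 2 * (B ^ 2 + 8) + 1 := by
        have h1 := integral_exp_neg_le_one hX h
        have h2 : θ ^ 2 * (B ^ 2 + 8 * ∫ ω, Real.exp (-X ω) ∂P) ≤ θ ^ 2 * (B ^ 2 + 8) := by
          gcongr; linarith
        linarith
    _ ≤ _ := Real.add_one_le_exp _

/-- Exponential lower deviation bound for i.i.d. sums whose increments satisfy `E exp (-X) ≤ 1`. -/
lemma measureReal_sum_le_le [IsProbabilityMeasure P] {X : ℕ → Ω → ℝ} (hX : ∀ i, Measurable (X i))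
    (hind : iIndepFun X P) (hid : ∀ i, IdentDistrib (X i) (X 0) P P)
    (h : ∫⁻ ω, ENNReal.ofReal (Real.exp (-X 0 ω)) ∂P ≤ 1) {B ε a : ℝ} (hB : 0 ≤ B)
    (hε : 0 < ε) (hε' : ε ≤ 8) (ha : a - ε ≤ ∫ ω, min (X 0 ω) B ∂P) (n : ℕ) :
    P.real {ω | ∑ i ∈ Finset.range n, X i ω ≤ n * (a - 2 * ε)} ≤
      Real.exp (-(ε ^ 2 / (4 * (B ^ 2 + 8)))) ^ n := by
  set C := B ^ 2 + 8 with hC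
  have hC8 : 8 ≤ C := by nlinarith
  have hC0 : 0 < C := by linarith
  -- This `θ` minimises the exponent per step, `-θ ε + θ ^ 2 C`, with value `-ε ^ 2 / (4 C)`. The
  -- bound `ε ≤ 8 ≤ C` keeps `θ ≤ 1 / 2`.
  set θ := ε / (2 * C) with hθ
  have hθ0 : 0 ≤ θ := by positivity
  have hθ2 : θ ≤ 1 / 2 := by
    rw [hθ, div_le_div_iff₀ (by positivity) two_pos]; linarith
  have hmeas : Measurable fun ω => Real.exp (-θ * X 0 ω) := by fun_prop
  have hint0 : Integrable (fun ω => Real.exp (-θ * X 0 ω)) P := by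
    refine ((integrable_exp_neg_of_lintegral_le_one (hX 0) h).add (integrable_const 1)).mono'
      hmeas.aestronglyMeasurable (ae_of_all _ fun ω => ?_)
    rw [Real.norm_eq_abs, abs_of_pos (Real.exp_pos _), Pi.add_apply]
    rcases le_or_gt 0 (X 0 ω) with hx | hx
    · have : Real.exp (-θ * X 0 ω) ≤ 1 := Real.exp_le_one_iff.2 (by nlinarith)
      linarith [Real.exp_pos (-X 0 ω)]
    · have : Real.exp (-θ * X 0 ω) ≤ Real.exp (-X 0 ω) := Real.exp_le_exp.2 (by nlinarith)
      linarith
  have hint : ∀ i ∈ Finset.range n, Integrable (fun ω => Real.exp (-θ * X i ω)) P := fun i _ =>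
    ((hid i).comp (u := fun x => Real.exp (-θ * x)) (by fun_prop)).integrable_iff.2 hint0
  have hsum := hind.integrable_exp_mul_sum hX hint
  have hmgf : mgf (∑ i ∈ Finset.range n, X i) P (-θ) = mgf (X 0) P (-θ) ^ n := by
    rw [hind.mgf_sum hX, Finset.prod_congr rfl (g := fun _ => mgf (X 0) P (-θ)),
      Finset.prod_const, Finset.card_range]
    exact fun i _ => congrFun (mgf_congr_identDistrib (hid i)) _
  have h1 := measure_le_le_exp_mul_mgf (n * (a - 2 * ε)) (neg_nonpos.2 hθ0) hsum
  simp only [Finset.sum_apply] at h1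
  refine h1.trans ?_
  rw [hmgf]
  have h2 : mgf (X 0) P (-θ) ≤ Real.exp (-(θ * (a - ε)) + θ ^ 2 * C) := by
    refine (mgf_neg_le (hX 0) h hB hθ0 hθ2).trans (Real.exp_le_exp.2 ?_)
    have := mul_le_mul_of_nonneg_left ha hθ0
    linarith
  calc _ ≤ Real.exp (- -θ * (n * (a - 2 * ε))) *
        Real.exp (-(θ * (a - ε)) + θ ^ 2 * C) ^ n := by
        gcongr
        exact mgf_nonneg
    _ = _ := by
        rw [← Real.exp_nat_mul, ← Real.exp_nat_mul, ← Real.exp_add]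
        congr 1
        rw [hθ]
        field_simp
        ring

end LowerDeviation

/-! ### I.i.d. streams -/

section IIDStream

variable {X : Type*} [MeasurableSpace X]

/-- The observations of the stream with law `Q` are independent and identically distributed. -/
def IIDStream (Q : Measure (ℕ → X)) : Prop :=
  iIndepFun (fun (n : ℕ) (x : ℕ → X) => x n) Q ∧
    ∀ n, IdentDistrib (fun x : ℕ → X => x n) (fun x => x 0) Q Q

/-- The law of a single observation. -/
noncomputable abbrev obsLaw (Q : Measure (ℕ → X)) : Measure X := Q.map fun x => x 0

instance (Q : Measure (ℕ → X)) [IsProbabilityMeasure Q] : IsProbabilityMeasure (obsLaw Q) :=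
  Measure.isProbabilityMeasure_map (measurable_pi_apply 0).aemeasurable

variable {Q Q₀ Q₁ : Measure (ℕ → X)}

lemma IIDStream.map_streamPrefix [IsProbabilityMeasure Q] (h : IIDStream Q) (n : ℕ) :
    Q.map (streamPrefix n) = Measure.pi fun _ : Fin n => obsLaw Q := by
  have h1 := (iIndepFun_iff_map_fun_eq_pi_map (μ := Q) (f := fun (i : Fin n) (x : ℕ → X) => x i)
    fun i => (measurable_pi_apply _).aemeasurable).1 (h.1.precomp Fin.val_injective)
  refine h1.trans (congrArg Measure.pi (funext fun i => (h.2 i).map_eq))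

lemma obsLaw_ac (h : Q₁.map (streamPrefix 1) ≪ Q₀.map (streamPrefix 1)) :
    obsLaw Q₁ ≪ obsLaw Q₀ := by
  have hm : Measurable fun y : Fin 1 → X => y 0 := measurable_pi_apply 0
  have := h.map hm
  rwa [Measure.map_map hm (measurable_streamPrefix 1),
    Measure.map_map hm (measurable_streamPrefix 1)] at this

/-- The log-likelihood ratio of a single observation. -/
noncomputable abbrev obsLLR (Q₀ Q₁ : Measure (ℕ → X)) : X → ℝ := llr (obsLaw Q₁) (obsLaw Q₀)

/-- The law of the prefix is a power of the law of one observation, so the log-likelihood ratio is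
additive. Densities are fixed only up to null sets of `Q₀`, hence the domination assumed of `Q`. -/
lemma streamLLR_ae_eq_sum [IsProbabilityMeasure Q₀] [IsProbabilityMeasure Q₁]
    (h₀ : IIDStream Q₀) (h₁ : IIDStream Q₁)
    (h₀₁ : ∀ n, Q₀.map (streamPrefix n) ≪ Q₁.map (streamPrefix n))
    (h₁₀ : ∀ n, Q₁.map (streamPrefix n) ≪ Q₀.map (streamPrefix n)) (n : ℕ)
    (hQ : Q.map (streamPrefix n) ≪ Q₀.map (streamPrefix n)) :
    ∀ᵐ x ∂Q, streamLLR Q₀ Q₁ n x = ∑ i ∈ Finset.range n, obsLLR Q₀ Q₁ (x i) := by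
  have h2 := llr_pi (fun _ : Fin n => obsLaw Q₀) (fun _ => obsLaw Q₁)
    (fun _ => obsLaw_ac (h₁₀ 1)) (fun _ => obsLaw_ac (h₀₁ 1))
  rw [← h₀.map_streamPrefix, ← h₁.map_streamPrefix] at h2
  filter_upwards [ae_of_ae_map (measurable_streamPrefix n).aemeasurable (hQ.ae_le h2)] with x hx
  rw [streamLLR, hx, Finset.sum_range]
  rfl

/-- The integrand is the density of `Q₀` with respect to `Q₁` on one observation. This is the
exponential moment on which the deviation bound for signals runs; the next lemma is its mirror image
for noise. -/
lemma lintegral_exp_neg_obsLLR_le [IsProbabilityMeasure Q₀] [IsProbabilityMeasure Q₁]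
    (h : obsLaw Q₁ ≪ obsLaw Q₀) :
    ∫⁻ x, ENNReal.ofReal (Real.exp (-obsLLR Q₀ Q₁ (x 0))) ∂Q₁ ≤ 1 := by
  rw [← lintegral_map (f := fun y => ENNReal.ofReal (Real.exp (-obsLLR Q₀ Q₁ y)))
    (by fun_prop) (measurable_pi_apply 0)]
  calc _ = ∫⁻ y, (obsLaw Q₀).rnDeriv (obsLaw Q₁) y ∂(obsLaw Q₁) := by
        refine lintegral_congr_ae ?_
        filter_upwards [exp_neg_llr h, Measure.rnDeriv_lt_top (obsLaw Q₀) (obsLaw Q₁)]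
          with y hy hlt
        rw [hy, ENNReal.ofReal_toReal hlt.ne]
    _ ≤ obsLaw Q₀ Set.univ := Measure.lintegral_rnDeriv_le
    _ ≤ 1 := prob_le_one

lemma lintegral_exp_obsLLR_le [IsProbabilityMeasure Q₀] [IsProbabilityMeasure Q₁]
    (h : obsLaw Q₀ ≪ obsLaw Q₁) :
    ∫⁻ x, ENNReal.ofReal (Real.exp (obsLLR Q₀ Q₁ (x 0))) ∂Q₀ ≤ 1 := by
  rw [← lintegral_map (f := fun y => ENNReal.ofReal (Real.exp (obsLLR Q₀ Q₁ y)))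
    (by fun_prop) (measurable_pi_apply 0)]
  calc _ = ∫⁻ y, (obsLaw Q₁).rnDeriv (obsLaw Q₀) y ∂(obsLaw Q₀) := by
        refine lintegral_congr_ae ?_
        filter_upwards [exp_llr_of_ac' _ _ h, Measure.rnDeriv_lt_top (obsLaw Q₁) (obsLaw Q₀)]
          with y hy hlt
        rw [hy, ENNReal.ofReal_toReal hlt.ne]
    _ ≤ obsLaw Q₁ Set.univ := Measure.lintegral_rnDeriv_le
    _ ≤ 1 := prob_le_one

end IIDStream

/-! ### Truncated means -/

section Truncation

variable {Ω : Type*} [MeasurableSpace Ω] {P : Measure Ω} [IsProbabilityMeasure P]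

/-- A truncated mean is close to the mean when the variance is bounded. -/
lemma le_integral_min_of_evariance_le {X : Ω → ℝ} (hX : Measurable X) {K : NNReal}
    (hK : evariance X P ≤ K) {a B : ℝ} (ha : a ≤ ∫ ω, X ω ∂P) (haB : a < B) :
    a - K / (4 * (B - a)) ≤ ∫ ω, min (X ω) B ∂P := by
  have hL2 : MemLp X 2 P := (evariance_lt_top_iff_memLp hX.aestronglyMeasurable).1
    (hK.trans_lt ENNReal.coe_lt_top)
  have hint : Integrable X P := hL2.integrable one_le_two
  have hvar : variance X P ≤ K := by
    refine (ENNReal.ofReal_le_ofReal_iff K.coe_nonneg).1 ?_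
    rw [hL2.ofReal_variance_eq]
    simpa using hK
  set I := ∫ ω, X ω ∂P with hI
  set d := B - a with hd
  have hd0 : 0 < d := sub_pos.2 haB
  have hsq : Integrable (fun ω => (X ω - I) ^ 2) P := (hL2.sub (memLp_const I)).integrable_sq
  have hvar' : ∫ ω, (X ω - I) ^ 2 ∂P ≤ K := by
    rwa [variance_eq_integral hX.aemeasurable] at hvar
  -- A parabola below both branches of the minimum: below `X` because `a ≤ I`, and tangent from
  -- below to the level `B` at `X = I + 2 d`. On integration the linear term vanishes and the
  -- variance remains.
  have hpt : ∀ ω, X ω - I + a - (X ω - I) ^ 2 * (1 / (4 * d)) ≤ min (X ω) B := by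
    intro ω
    have h1 : 0 ≤ (X ω - I) ^ 2 * (1 / (4 * d)) := by positivity
    refine le_min (by linarith) ?_
    have h2 : (X ω - I) ^ 2 * (1 / (4 * d)) - (X ω - I) + d =
        (X ω - I - 2 * d) ^ 2 * (1 / (4 * d)) := by field_simp; ring
    have h3 : 0 ≤ (X ω - I - 2 * d) ^ 2 * (1 / (4 * d)) := by positivity
    linarith
  have hi0 : Integrable (fun ω => X ω - I) P := hint.sub (integrable_const I)
  have hi1 : Integrable (fun ω => X ω - I + a) P := hi0.add (integrable_const a)
  have hmin : Integrable (fun ω => min (X ω) B) P := hint.inf (integrable_const B)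
  have h1 := integral_mono (hi1.sub (hsq.mul_const (1 / (4 * d)))) hmin hpt
  refine le_trans ?_ h1
  rw [integral_sub' hi1 (hsq.mul_const _), integral_mul_const,
    integral_add hi0 (integrable_const a),
    integral_sub hint (integrable_const I)]
  simp only [integral_const, probReal_univ, one_smul, ← hI, sub_self, zero_add]
  rw [← mul_one_div]
  gcongr

lemma tendsto_integral_min {X : Ω → ℝ} (hX : Integrable X P) :
    Tendsto (fun B : ℕ => ∫ ω, min (X ω) B ∂P) atTop (𝓝 (∫ ω, X ω ∂P)) := by
  refine tendsto_integral_of_dominated_convergence (fun ω => |X ω|)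
    (fun B => (hX.inf (integrable_const _)).aestronglyMeasurable) hX.abs
    (fun B => ae_of_all _ fun ω => ?_) (ae_of_all _ fun ω => ?_)
  · have hB : (0 : ℝ) ≤ B := Nat.cast_nonneg B
    rw [Real.norm_eq_abs, abs_le]
    refine ⟨le_min (neg_abs_le _) ?_, (min_le_left _ _).trans (le_abs_self _)⟩
    linarith [abs_nonneg (X ω)]
  · refine tendsto_const_nhds.congr' ?_
    filter_upwards [eventually_ge_atTop ⌈X ω⌉₊] with B hB
    exact (min_eq_left ((Nat.le_ceil _).trans (by exact_mod_cast hB))).symm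

/-- A variable with `E exp (-X) ≤ 1` and nonpositive mean vanishes. -/
lemma ae_eq_zero_of_integral_nonpos {X : Ω → ℝ} (hX : Measurable X) (hint : Integrable X P)
    (h : ∫⁻ ω, ENNReal.ofReal (Real.exp (-X ω)) ∂P ≤ 1) (hI : ∫ ω, X ω ∂P ≤ 0) :
    X =ᵐ[P] 0 := by
  have hexp := integrable_exp_neg_of_lintegral_le_one hX h
  have h1 := integral_exp_neg_le_one hX h
  have hg0 : Integrable (fun ω => Real.exp (-X ω) - 1) P := hexp.sub (integrable_const 1)
  have hg : Integrable (fun ω => Real.exp (-X ω) - 1 + X ω) P := hg0.add hint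
  -- This nonnegative function has nonpositive integral, so it vanishes almost everywhere, and
  -- equality in `1 + x ≤ exp x` holds only at `0`.
  have hnn : 0 ≤ fun ω => Real.exp (-X ω) - 1 + X ω := fun ω => by
    have := Real.add_one_le_exp (-X ω)
    simp only [Pi.zero_apply]
    linarith
  have h2 : ∫ ω, (Real.exp (-X ω) - 1 + X ω) ∂P = 0 := by
    refine le_antisymm ?_ (integral_nonneg hnn)
    rw [integral_add hg0 hint,
      integral_sub hexp (integrable_const 1)]
    simp only [integral_const, probReal_univ, one_smul]
    linarith
  filter_upwards [(integral_eq_zero_iff_of_nonneg hnn hg).1 h2] with ω hω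
  by_contra hne
  have := Real.add_one_lt_exp (neg_ne_zero.2 hne)
  simp only [Pi.zero_apply] at hω
  linarith

end Truncation

namespace StreamModel

variable {J : ℕ} (M : StreamModel.{u} J)

/-! ### Single streams under the i.i.d. assumption -/

lemma IsIID.stream₀ {M : StreamModel.{u} J} (hM : M.IsIID) (j : Fin J) : IIDStream (M.P₀ j) := (hM j).1

lemma IsIID.stream₁ {M : StreamModel.{u} J} (hM : M.IsIID) (j : Fin J) : IIDStream (M.P₁ j) := (hM j).2

lemma IsIID.stream_marg {M : StreamModel.{u} J} (hM : M.IsIID) (A : Finset (Fin J)) (j : Fin J) : IIDStream (M.marg A j) := by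
  unfold marg; split_ifs
  exacts [hM.stream₁ j, hM.stream₀ j]

lemma marg_ac₀ (A : Finset (Fin J)) (j : Fin J) (n : ℕ) :
    (M.marg A j).map (streamPrefix n) ≪ (M.P₀ j).map (streamPrefix n) := by
  unfold marg; split_ifs
  exacts [M.ac₁₀ j n, .rfl]

/-- The log-likelihood ratio of a single observation of stream `j`. -/
noncomputable def incr (j : Fin J) : M.Obs j → ℝ := obsLLR (M.P₀ j) (M.P₁ j)

lemma measurable_incr (j : Fin J) : Measurable (M.incr j) := measurable_llr _ _

lemma IsIID.streamLLR_ae_eq {M : StreamModel.{u} J} (hM : M.IsIID) (A : Finset (Fin J))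
    (j : Fin J) (n : ℕ) : ∀ᵐ x ∂(M.marg A j),
      streamLLR (M.P₀ j) (M.P₁ j) n x = ∑ i ∈ Finset.range n, M.incr j (x i) :=
  streamLLR_ae_eq_sum (hM.stream₀ j) (hM.stream₁ j) (M.ac₀₁ j) (M.ac₁₀ j) n (M.marg_ac₀ A j n)

lemma IsIID.streamLLR_one_ae_eq₀ {M : StreamModel.{u} J} (hM : M.IsIID) (j : Fin J) :
    ∀ᵐ x ∂(M.P₀ j), streamLLR (M.P₀ j) (M.P₁ j) 1 x = M.incr j (x 0) := by
  simpa [marg] using hM.streamLLR_ae_eq ∅ j 1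

lemma IsIID.streamLLR_one_ae_eq₁ {M : StreamModel.{u} J} (hM : M.IsIID) (j : Fin J) :
    ∀ᵐ x ∂(M.P₁ j), streamLLR (M.P₀ j) (M.P₁ j) 1 x = M.incr j (x 0) := by
  simpa [marg] using hM.streamLLR_ae_eq Finset.univ j 1

lemma lintegral_exp_neg_incr_le (j : Fin J) :
    ∫⁻ x, ENNReal.ofReal (Real.exp (-M.incr j (x 0))) ∂(M.P₁ j) ≤ 1 :=
  lintegral_exp_neg_obsLLR_le (obsLaw_ac (M.ac₁₀ j 1))

lemma lintegral_exp_incr_le (j : Fin J) :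
    ∫⁻ x, ENNReal.ofReal (Real.exp (- -M.incr j (x 0))) ∂(M.P₀ j) ≤ 1 := by
  simp only [neg_neg]
  exact lintegral_exp_obsLLR_le (obsLaw_ac (M.ac₀₁ j 1))

lemma measurable_incr_eval (j : Fin J) (i : ℕ) :
    Measurable fun x : ℕ → M.Obs j => M.incr j (x i) :=
  (M.measurable_incr j).comp (measurable_pi_apply i)

lemma IsIID.law_lam_le {M : StreamModel.{u} J} (hM : M.IsIID) {A : Finset (Fin J)} {j : Fin J}
    (hj : j ∈ A) {B ε a : ℝ} (hB : 0 ≤ B) (hε : 0 < ε) (hε' : ε ≤ 8)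
    (ha : a - ε ≤ ∫ x, min (M.incr j (x 0)) B ∂(M.P₁ j)) (n : ℕ) :
    (M.law A).real {ω | M.lam j n ω ≤ n * (a - 2 * ε)} ≤
      Real.exp (-(ε ^ 2 / (4 * (B ^ 2 + 8)))) ^ n := by
  have h1 := measureReal_sum_le_le (P := M.P₁ j) (X := fun i x => M.incr j (x i))
    (fun i => M.measurable_incr_eval j i)
    ((hM.stream₁ j).1.comp (fun _ => M.incr j) fun _ => M.measurable_incr j)
    (fun i => ((hM.stream₁ j).2 i).comp (M.measurable_incr j))
    (M.lintegral_exp_neg_incr_le j) hB hε hε' ha n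
  refine le_trans ?_ h1
  have h2 := hM.streamLLR_ae_eq A j n
  have hmeas : MeasurableSet {x : ℕ → M.Obs j |
      ∑ i ∈ Finset.range n, M.incr j (x i) ≤ n * (a - 2 * ε)} :=
    measurableSet_le (Finset.measurable_sum _ fun i _ => M.measurable_incr_eval j i)
      measurable_const
  have h3 := (M.measurePreserving_eval_law A j).measureReal_preimage hmeas.nullMeasurableSet
  have h4 : M.marg A j = M.P₁ j := if_pos hj
  rw [h4] at h3
  rw [← h3]
  refine ENNReal.toReal_mono (measure_ne_top _ _) (measure_mono_ae ?_)
  filter_upwards [M.ae_law_of_marg A j h2] with ω hω h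
  change M.lam j n ω ≤ _ at h
  rw [lam, hω] at h
  exact h

lemma IsIID.law_neg_lam_le {M : StreamModel.{u} J} (hM : M.IsIID) {A : Finset (Fin J)}
    {j : Fin J} (hj : j ∉ A) {B ε a : ℝ} (hB : 0 ≤ B) (hε : 0 < ε) (hε' : ε ≤ 8)
    (ha : a - ε ≤ ∫ x, min (-M.incr j (x 0)) B ∂(M.P₀ j)) (n : ℕ) :
    (M.law A).real {ω | -M.lam j n ω ≤ n * (a - 2 * ε)} ≤
      Real.exp (-(ε ^ 2 / (4 * (B ^ 2 + 8)))) ^ n := by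
  have h1 := measureReal_sum_le_le (P := M.P₀ j) (X := fun i x => -M.incr j (x i))
    (fun i => (M.measurable_incr_eval j i).neg)
    ((hM.stream₀ j).1.comp (fun _ y => -M.incr j y) fun _ => (M.measurable_incr j).neg)
    (fun i => ((hM.stream₀ j).2 i).comp (M.measurable_incr j).neg)
    (M.lintegral_exp_incr_le j) hB hε hε' ha n
  refine le_trans ?_ h1
  have h2 := hM.streamLLR_ae_eq A j n
  have hmeas : MeasurableSet {x : ℕ → M.Obs j |
      ∑ i ∈ Finset.range n, -M.incr j (x i) ≤ n * (a - 2 * ε)} :=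
    measurableSet_le (Finset.measurable_sum _ fun i _ => (M.measurable_incr_eval j i).neg)
      measurable_const
  have h3 := (M.measurePreserving_eval_law A j).measureReal_preimage hmeas.nullMeasurableSet
  have h4 : M.marg A j = M.P₀ j := if_neg hj
  rw [h4] at h3
  rw [← h3]
  refine ENNReal.toReal_mono (measure_ne_top _ _) (measure_mono_ae ?_)
  filter_upwards [M.ae_law_of_marg A j h2] with ω hω h
  change -M.lam j n ω ≤ _ at h
  rw [lam, hω, ← Finset.sum_neg_distrib] at h
  exact h

/-! ### Information numbers -/

lemma IsIID.info₁_eq {M : StreamModel.{u} J} (hM : M.IsIID) (j : Fin J) :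
    M.info₁ j = ∫ x, M.incr j (x 0) ∂(M.P₁ j) :=
  integral_congr_ae (hM.streamLLR_one_ae_eq₁ j)

lemma IsIID.info₀_eq {M : StreamModel.{u} J} (hM : M.IsIID) (j : Fin J) :
    M.info₀ j = ∫ x, -M.incr j (x 0) ∂(M.P₀ j) := by
  refine integral_congr_ae ?_
  filter_upwards [hM.streamLLR_one_ae_eq₀ j] with x hx
  rw [hx]

/-- Otherwise every increment would vanish almost surely and the log-likelihood ratio would stay at
`0` instead of diverging. -/
lemma IsIID.info₁_pos {M : StreamModel.{u} J} (hM : M.IsIID) (j : Fin J)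
    (hint : Integrable (fun x => M.incr j (x 0)) (M.P₁ j)) : 0 < M.info₁ j := by
  by_contra hneg
  rw [not_lt, hM.info₁_eq j] at hneg
  have h0 := ae_eq_zero_of_integral_nonpos (M.measurable_incr_eval j 0) hint
    (M.lintegral_exp_neg_incr_le j) hneg
  have h1 : ∀ᵐ x ∂(M.P₁ j), ∀ i, M.incr j (x i) = 0 := ae_all_iff.2 fun i => by
    have := (((hM.stream₁ j).2 i).comp (M.measurable_incr j)).symm.ae_snd
      (p := fun y => y = 0) (measurableSet_singleton 0) h0
    exact this
  have h2 : ∀ᵐ x ∂(M.P₁ j), ∀ n,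
      streamLLR (M.P₀ j) (M.P₁ j) n x = ∑ i ∈ Finset.range n, M.incr j (x i) :=
    ae_all_iff.2 fun n => by simpa [marg] using hM.streamLLR_ae_eq Finset.univ j n
  obtain ⟨x, hx1, hx2, hx3⟩ := (h1.and (h2.and (M.tendsto₁ j))).exists
  simp only [hx2, hx1, Finset.sum_const_zero] at hx3
  exact not_tendsto_const_atTop _ _ hx3

lemma IsIID.info₀_pos {M : StreamModel.{u} J} (hM : M.IsIID) (j : Fin J)
    (hint : Integrable (fun x => M.incr j (x 0)) (M.P₀ j)) : 0 < M.info₀ j := by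
  by_contra hneg
  rw [not_lt, hM.info₀_eq j] at hneg
  have h0 := ae_eq_zero_of_integral_nonpos (M.measurable_incr_eval j 0).neg hint.neg
    (M.lintegral_exp_incr_le j) hneg
  have h1 : ∀ᵐ x ∂(M.P₀ j), ∀ i, M.incr j (x i) = 0 := ae_all_iff.2 fun i => by
    have := (((hM.stream₀ j).2 i).comp (M.measurable_incr j)).symm.ae_snd
      (p := fun y => y = 0) (measurableSet_singleton 0) (by
        filter_upwards [h0] with x hx
        simpa using hx)
    exact this
  have h2 : ∀ᵐ x ∂(M.P₀ j), ∀ n,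
      streamLLR (M.P₀ j) (M.P₁ j) n x = ∑ i ∈ Finset.range n, M.incr j (x i) :=
    ae_all_iff.2 fun n => by simpa [marg] using hM.streamLLR_ae_eq ∅ j n
  obtain ⟨x, hx1, hx2, hx3⟩ := (h1.and (h2.and (M.tendsto₀ j))).exists
  simp only [hx2, hx1, Finset.sum_const_zero] at hx3
  exact not_tendsto_const_atBot _ _ hx3

lemma eta₁_le {A : Finset (Fin J)} {j : Fin J} (hj : j ∈ A) : M.eta₁ A ≤ M.info₁ j :=
  ciInf_le (Set.finite_range _).bddBelow (⟨j, hj⟩ : {j : Fin J // j ∈ A})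

lemma eta₀_le {A : Finset (Fin J)} {j : Fin J} (hj : j ∉ A) : M.eta₀ A ≤ M.info₀ j :=
  ciInf_le (Set.finite_range _).bddBelow (⟨j, hj⟩ : {j : Fin J // j ∉ A})

lemma exists_eta₁_eq {m : ℕ} (hm : 1 ≤ m ∧ m < J) {A : Finset (Fin J)} (hA : A.card = m) :
    ∃ j ∈ A, M.eta₁ A = M.info₁ j := by
  have hne : A.Nonempty := Finset.card_pos.1 (by omega)
  have : Nonempty {j : Fin J // j ∈ A} := hne.to_subtype
  obtain ⟨⟨j, hj⟩, h⟩ := exists_eq_ciInf_of_finite (f := fun j : {j : Fin J // j ∈ A} => M.info₁ j)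
  exact ⟨j, hj, h.symm⟩

lemma exists_eta₀_eq {m : ℕ} (hm : 1 ≤ m ∧ m < J) {A : Finset (Fin J)} (hA : A.card = m) :
    ∃ j ∉ A, M.eta₀ A = M.info₀ j := by
  obtain ⟨k, hk⟩ : ∃ k, k ∉ A := by
    by_contra! h
    have := Finset.card_le_card (show Finset.univ ⊆ A from fun k _ => h k)
    rw [Finset.card_univ, Fintype.card_fin] at this
    omega
  have : Nonempty {j : Fin J // j ∉ A} := ⟨⟨k, hk⟩⟩
  obtain ⟨⟨j, hj⟩, h⟩ := exists_eq_ciInf_of_finite (f := fun j : {j : Fin J // j ∉ A} => M.info₀ j)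
  exact ⟨j, hj, h.symm⟩

/-! ### The expected sample size of the gap rule -/

/-- If the rule is still running, some stream lags behind its drift line, for otherwise all signals
exceed all noise streams by `c`. Comparing each stream with its own line, rather than streams in
pairs, gives the factor `J`. -/
lemma IsIID.law_lt_gapT_le {M : StreamModel.{u} J} (hM : M.IsIID) {m : ℕ}
    (hm : 1 ≤ m ∧ m < J) {A : Finset (Fin J)} (hA : A.card = m) {B ε c a₀ a₁ : ℝ} (hB : 0 ≤ B)
    (hε : 0 < ε) (hε' : ε ≤ 8) (hc : 0 < c)
    (h₁ : ∀ j ∈ A, a₁ - ε ≤ ∫ x, min (M.incr j (x 0)) B ∂(M.P₁ j))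
    (h₀ : ∀ j ∉ A, a₀ - ε ≤ ∫ x, min (-M.incr j (x 0)) B ∂(M.P₀ j)) {n : ℕ} (hn : 1 ≤ n)
    (hcn : c ≤ n * (a₁ + a₀ - 4 * ε)) :
    (M.law A).real {ω | (n : ℕ∞) < M.gapT m hm c ω} ≤
      J * Real.exp (-(ε ^ 2 / (4 * (B ^ 2 + 8)))) ^ n := by
  have hsub : {ω | (n : ℕ∞) < M.gapT m hm c ω} ⊆ ⋃ j ∈ (Finset.univ : Finset (Fin J)),
      {ω | if j ∈ A then M.lam j n ω ≤ n * (a₁ - 2 * ε)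
        else -M.lam j n ω ≤ n * (a₀ - 2 * ε)} := by
    intro ω hω
    by_contra hno
    simp only [Set.mem_iUnion, Finset.mem_univ, exists_prop, true_and, not_exists,
      Set.mem_ofPred_eq] at hno
    refine (not_le.2 hω) ((M.gapT_le_iff m hm c n ω).2
      ⟨n, le_rfl, hn, M.le_gap hm hA hc fun j hj k hk => ?_⟩)
    have hj' := hno j
    have hk' := hno k
    rw [if_pos hj, not_le] at hj'
    rw [if_neg hk, not_le] at hk'
    linarith
  refine (measureReal_mono hsub (measure_ne_top _ _)).trans
    ((measureReal_biUnion_finset_le _ _).trans ?_)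
  calc _ ≤ ∑ _j : Fin J, Real.exp (-(ε ^ 2 / (4 * (B ^ 2 + 8)))) ^ n := by
        refine Finset.sum_le_sum fun j _ => ?_
        by_cases hj : j ∈ A
        · simp only [hj, if_true]
          exact hM.law_lam_le hj hB hε hε' (h₁ j hj) n
        · simp only [hj, if_false]
          exact hM.law_neg_lam_le hj hB hε hε' (h₀ j hj) n
    _ = _ := by simp

/-- The tail-sum formula for the expectation, with the first `n₀` tails bounded by one. -/
lemma natCast_le_add_tsum (n₀ k : ℕ) :
    ((k : ℕ∞) : ℝ≥0∞) ≤ n₀ + ∑' n : ℕ, if n₀ ≤ n ∧ (n : ℕ∞) < (k : ℕ∞) then 1 else 0 := by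
  have h1 := ENNReal.sum_le_tsum (f := fun n : ℕ =>
    if n₀ ≤ n ∧ (n : ℕ∞) < (k : ℕ∞) then (1 : ℝ≥0∞) else 0) (Finset.Ico n₀ k)
  rw [Finset.sum_congr rfl (g := fun _ => (1 : ℝ≥0∞))] at h1
  · rw [Finset.sum_const, Nat.card_Ico, nsmul_eq_mul, mul_one] at h1
    refine le_trans ?_ (add_le_add_right h1 _)
    have : k ≤ n₀ + (k - n₀) := by omega
    rw [ENat.toENNReal_coe]
    exact_mod_cast this
  · intro n hn
    rw [Finset.mem_Ico] at hn
    rw [if_pos]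
    exact ⟨hn.1, by exact_mod_cast hn.2⟩

/-- Nonasymptotic upper bound for the expected sample size of the gap rule. -/
lemma IsIID.expT_gapRule_le {M : StreamModel.{u} J} (hM : M.IsIID) {m : ℕ}
    (hm : 1 ≤ m ∧ m < J) {A : Finset (Fin J)} (hA : A.card = m) {B ε c a₀ a₁ : ℝ} (hB : 0 ≤ B)
    (hε : 0 < ε) (hε' : ε ≤ 8) (hc : 0 < c)
    (h₁ : ∀ j ∈ A, a₁ - ε ≤ ∫ x, min (M.incr j (x 0)) B ∂(M.P₁ j))
    (h₀ : ∀ j ∉ A, a₀ - ε ≤ ∫ x, min (-M.incr j (x 0)) B ∂(M.P₀ j))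
    (ha : 0 < a₁ + a₀ - 4 * ε) :
    M.expT A (M.gapRule m hm c) ≤ ENNReal.ofReal (c / (a₁ + a₀ - 4 * ε) + 1 +
      J * (1 - Real.exp (-(ε ^ 2 / (4 * (B ^ 2 + 8)))))⁻¹) := by
  set ρ := Real.exp (-(ε ^ 2 / (4 * (B ^ 2 + 8)))) with hρ
  have hρ0 : 0 ≤ ρ := (Real.exp_pos _).le
  have hρ1 : ρ < 1 := by
    rw [hρ, Real.exp_lt_one_iff, neg_lt_zero]; positivity
  -- From `n₀` on the joint drift covers the threshold and the tail is geometric. Rounding up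
  -- accounts for the summand `1` of the bound.
  set n₀ := ⌈c / (a₁ + a₀ - 4 * ε)⌉₊ with hn₀
  have hn₀1 : 1 ≤ n₀ := Nat.one_le_iff_ne_zero.2 (Nat.ceil_pos.2 (div_pos hc ha)).ne'
  have hmeas : ∀ n : ℕ, MeasurableSet {ω | (n : ℕ∞) < M.gapT m hm c ω} := fun n => by
    have := (M.filt.le n _ ((M.isStoppingTime_gapT m hm c) n)).compl
    convert this using 1
    ext ω
    exact (not_le (a := M.gapT m hm c ω) (b := (n : ℕ∞))).symm
  have hpt : ∀ᵐ ω ∂(M.law A), ((M.gapT m hm c ω : ℕ∞) : ℝ≥0∞) ≤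
      n₀ + ∑' n : ℕ, if n₀ ≤ n then
        {ω | (n : ℕ∞) < M.gapT m hm c ω}.indicator (fun _ => (1 : ℝ≥0∞)) ω else 0 := by
    filter_upwards [M.ae_gapT_ne_top hm hA hc] with ω hω
    obtain ⟨k, hk⟩ := ENat.ne_top_iff_exists.1 hω
    refine (hk ▸ natCast_le_add_tsum n₀ k).trans_eq ?_
    congr 2
    ext n
    by_cases h1 : n₀ ≤ n <;> simp [h1, Set.indicator_apply, ← hk]
  have htail : ∀ n : ℕ, ∫⁻ ω, (if n₀ ≤ n then
        {ω | (n : ℕ∞) < M.gapT m hm c ω}.indicator (fun _ => (1 : ℝ≥0∞)) ω else 0) ∂(M.law A) ≤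
        ENNReal.ofReal (J * ρ ^ n) := by
    intro n
    by_cases h1 : n₀ ≤ n
    · simp only [h1, if_true]
      rw [lintegral_indicator_const (hmeas n), one_mul, ← ofReal_measureReal]
      refine ENNReal.ofReal_le_ofReal (hM.law_lt_gapT_le hm hA hB hε hε' hc h₁ h₀
        (hn₀1.trans h1) ?_)
      rw [← div_le_iff₀ ha]
      exact (Nat.le_ceil _).trans (by exact_mod_cast h1)
    · simp [h1]
  have hgeo := (hasSum_geometric_of_lt_one hρ0 hρ1).mul_left (J : ℝ)
  calc M.expT A (M.gapRule m hm c) ≤ _ := lintegral_mono_ae hpt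
    _ = n₀ + ∑' n : ℕ, ∫⁻ ω, (if n₀ ≤ n then
        {ω | (n : ℕ∞) < M.gapT m hm c ω}.indicator (fun _ => (1 : ℝ≥0∞)) ω else 0) ∂(M.law A) := by
        rw [lintegral_add_left measurable_const, lintegral_tsum]
        · simp
        · intro n
          by_cases h1 : n₀ ≤ n
          · simp only [h1, if_true]
            exact (measurable_const.indicator (hmeas n)).aemeasurable
          · simp [h1]
    _ ≤ n₀ + ∑' n : ℕ, ENNReal.ofReal (J * ρ ^ n) := by gcongr with n; exact htail n
    _ = n₀ + ENNReal.ofReal (J * (1 - ρ)⁻¹) := by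
        rw [← hgeo.tsum_eq, ENNReal.ofReal_tsum_of_nonneg (fun n => by positivity) hgeo.summable]
    _ ≤ ENNReal.ofReal (c / (a₁ + a₀ - 4 * ε) + 1) + ENNReal.ofReal (J * (1 - ρ)⁻¹) := by
        gcongr
        rw [← ENNReal.ofReal_natCast]
        exact ENNReal.ofReal_le_ofReal (Nat.ceil_lt_add_one (div_pos hc ha).le).le
    _ = _ := by
        rw [← ENNReal.ofReal_add (by positivity)
          (mul_nonneg (Nat.cast_nonneg J) (inv_nonneg.2 (by linarith)))]

end StreamModel

namespace StreamModel

variable {J : ℕ} {M : StreamModel.{u} J}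

/-! ### Wald's identity -/

lemma IsIID.iIndepFun_law (hM : M.IsIID) (A : Finset (Fin J)) :
    iIndepFun (fun (p : (_ : Fin J) × ℕ) (ω : M.Path) => ω p.1 p.2) (M.law A) := by
  have hmeas : ∀ (l : Fin J) (i : ℕ), Measurable fun ω : M.Path => ω l i := fun l i =>
    (measurable_pi_apply i).comp (measurable_pi_apply l)
  refine iIndepFun_uncurry (X := fun (l : Fin J) (i : ℕ) (ω : M.Path) => ω l i) hmeas ?_
    fun l => ?_
  · exact iIndepFun_pi (μ := M.marg A) (X := fun l (x : ℕ → M.Obs l) => x)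
      fun l => aemeasurable_id
  · have h1 := (iIndepFun_iff_map_fun_eq_infinitePi_map (P := M.marg A l)
      (X := fun (i : ℕ) (x : ℕ → M.Obs l) => x i) fun i => measurable_pi_apply i).1
      (hM.stream_marg A l).1
    rw [iIndepFun_iff_map_fun_eq_infinitePi_map (hmeas l)]
    have h2 : ∀ i, (M.law A).map (fun ω => ω l i) = (M.marg A l).map fun x => x i := fun i => by
      rw [← (M.measurePreserving_eval_law A l).map_eq,
        Measure.map_map (measurable_pi_apply i) (measurable_pi_apply l)]
      rfl
    simp only [h2, ← h1]
    exact (M.measurePreserving_eval_law A l).map_eq.trans Measure.map_id.symm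

/-- Time is indexed from `0`: the history at `i` consists of the observations with index below `i`,
so the one with index `i` is the first it does not contain. -/
lemma IsIID.indepFun_history (hM : M.IsIID) (A : Finset (Fin J)) (j : Fin J) (i : ℕ) :
    IndepFun (M.history i) (fun ω => ω j i) (M.law A) := by
  classical
  have hmeas : ∀ p : (_ : Fin J) × ℕ, Measurable fun ω : M.Path => ω p.1 p.2 := fun p =>
    (measurable_pi_apply p.2).comp (measurable_pi_apply p.1)
  let S : Finset ((_ : Fin J) × ℕ) := Finset.univ.sigma fun _ => Finset.range i
  let T : Finset ((_ : Fin J) × ℕ) := {⟨j, i⟩}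
  have hST : Disjoint S T := by
    rw [Finset.disjoint_singleton_right]
    simp [S]
  have h := (hM.iIndepFun_law A).indepFun_finset S T hST hmeas
  have hS : ∀ (l : Fin J) (r : Fin i), (⟨l, r⟩ : (_ : Fin J) × ℕ) ∈ S := fun l r => by
    simp [S]
  have hψ : Measurable fun y : ∀ p : T, M.Obs p.1.1 =>
      (y ⟨⟨j, i⟩, Finset.mem_singleton_self _⟩ : M.Obs j) :=
    measurable_pi_apply (⟨⟨j, i⟩, Finset.mem_singleton_self _⟩ : T)
  exact h.comp (φ := fun y l (r : Fin i) => y ⟨⟨l, r⟩, hS l r⟩)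
    (measurable_pi_lambda _ fun l => measurable_pi_lambda _ fun r => measurable_pi_apply _) hψ

lemma IsIID.identDistrib_marg (hM : M.IsIID) (A : Finset (Fin J)) (j : Fin J) (i : ℕ) :
    IdentDistrib (fun ω : M.Path => M.incr j (ω j i)) (fun x => M.incr j (x 0)) (M.law A)
      (M.marg A j) := by
  refine IdentDistrib.trans (ν := M.marg A j) (g := fun x => M.incr j (x i)) ?_
    (((hM.stream_marg A j).2 i).comp (M.measurable_incr j))
  have hm := M.measurable_incr_eval j i
  refine ⟨(hm.comp (measurable_pi_apply j)).aemeasurable, hm.aemeasurable, ?_⟩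
  rw [← (M.measurePreserving_eval_law A j).map_eq, Measure.map_map hm (measurable_pi_apply j)]
  rfl

lemma IsIID.setIntegral_incr (hM : M.IsIID) (A : Finset (Fin J)) (j : Fin J) (i : ℕ)
    {H : Set M.Path} (hH : MeasurableSet[M.filt i] H) :
    ∫ ω, H.indicator (fun _ => (1 : ℝ)) ω * M.incr j (ω j i) ∂(M.law A) =
      (M.law A).real H * ∫ x, M.incr j (x 0) ∂(M.marg A j) := by
  have hHm := M.filt.le i _ hH
  obtain ⟨t, ht, rfl⟩ := hH
  have h1 : IndepFun (t.indicator (fun _ => (1 : ℝ)) ∘ M.history i)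
      (M.incr j ∘ fun ω : M.Path => ω j i) (M.law A) :=
    (hM.indepFun_history A j i).comp (measurable_const.indicator ht) (M.measurable_incr j)
  have h2 := h1.integral_mul_eq_mul_integral
    ((measurable_const.indicator ht).comp (M.measurable_history i)).aestronglyMeasurable
    ((M.measurable_incr j).comp
      ((measurable_pi_apply i).comp (measurable_pi_apply j))).aestronglyMeasurable
  refine Eq.trans h2 ?_
  congr 1
  · have : (t.indicator (fun _ => (1 : ℝ)) ∘ M.history i) =
        (M.history i ⁻¹' t).indicator 1 := by
      rfl
    rw [this, integral_indicator_one hHm]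
  · exact (hM.identDistrib_marg A j i).integral_eq

/-- The log-likelihood ratio of signal `j` minus that of noise stream `k`, stopped at `δ.T`
or at the horizon `N`. -/
noncomputable def stoppedDiff (δ : M.Procedure) (j k : Fin J) (N : ℕ) (ω : M.Path) : ℝ :=
  ∑ i ∈ Finset.range N, {ω | (i : ℕ∞) < δ.T ω}.indicator (fun _ => (1 : ℝ)) ω *
    (M.incr j (ω j i) - M.incr k (ω k i))

lemma Procedure.measurableSet_lt (δ : M.Procedure) (i : ℕ) :
    MeasurableSet[M.filt i] {ω | (i : ℕ∞) < δ.T ω} := by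
  have h := (δ.isStoppingTime i).compl
  convert h using 1
  ext ω
  exact (not_le (a := δ.T ω) (b := (i : ℕ∞))).symm

lemma measurable_stoppedDiff (δ : M.Procedure) (j k : Fin J) (N : ℕ) :
    Measurable (M.stoppedDiff δ j k N) :=
  Finset.measurable_sum _ fun i _ =>
    (measurable_const.indicator (M.filt.le i _ (δ.measurableSet_lt i))).mul
      (((M.measurable_incr_eval j i).comp (measurable_pi_apply j)).sub
        ((M.measurable_incr_eval k i).comp (measurable_pi_apply k)))

lemma IsIID.integrable_indicator_mul_incr (hM : M.IsIID) (A : Finset (Fin J)) (j : Fin J)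
    (i : ℕ) (hint : Integrable (fun x => M.incr j (x 0)) (M.marg A j)) {H : Set M.Path}
    (hH : MeasurableSet H) :
    Integrable (fun ω => H.indicator (fun _ => (1 : ℝ)) ω * M.incr j (ω j i)) (M.law A) := by
  refine ((hM.identDistrib_marg A j i).integrable_iff.2 hint).bdd_mul (c := 1)
    (measurable_const.indicator hH).aestronglyMeasurable (ae_of_all _ fun ω => ?_)
  by_cases h : ω ∈ H <;> simp [h]

lemma IsIID.integrable_stoppedDiff (hM : M.IsIID) {A : Finset (Fin J)} {j k : Fin J}
    (hjint : Integrable (fun x => M.incr j (x 0)) (M.marg A j))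
    (hkint : Integrable (fun x => M.incr k (x 0)) (M.marg A k)) (δ : M.Procedure) (N : ℕ) :
    Integrable (M.stoppedDiff δ j k N) (M.law A) := by
  refine integrable_finsetSum _ fun i _ => ?_
  have hH := M.filt.le i _ (δ.measurableSet_lt i)
  simp only [mul_sub]
  exact (hM.integrable_indicator_mul_incr A j i hjint hH).sub
    (hM.integrable_indicator_mul_incr A k i hkint hH)

/-- Wald's identity: whether `i < T` is decided by the history at `i`, hence is independent of the
increment with index `i`, and every summand factorises. -/
lemma integral_stoppedDiff (hM : M.IsIID) {A : Finset (Fin J)} {j k : Fin J} (hj : j ∈ A)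
    (hk : k ∉ A) (hjint : Integrable (fun x => M.incr j (x 0)) (M.marg A j))
    (hkint : Integrable (fun x => M.incr k (x 0)) (M.marg A k)) (δ : M.Procedure) (N : ℕ) :
    ∫ ω, M.stoppedDiff δ j k N ω ∂(M.law A) =
      (∑ i ∈ Finset.range N, (M.law A).real {ω | (i : ℕ∞) < δ.T ω}) *
        (M.info₁ j + M.info₀ k) := by
  have hH := fun i => M.filt.le i _ (δ.measurableSet_lt i)
  have hj1 : ∫ x, M.incr j (x 0) ∂(M.marg A j) = M.info₁ j := by
    rw [hM.info₁_eq, marg, if_pos hj]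
  have hk1 : ∫ x, M.incr k (x 0) ∂(M.marg A k) = -M.info₀ k := by
    rw [hM.info₀_eq, marg, if_neg hk, integral_neg, neg_neg]
  unfold stoppedDiff
  simp only [mul_sub]
  have hint : ∀ i ∈ Finset.range N, Integrable (fun ω =>
      {ω | (i : ℕ∞) < δ.T ω}.indicator (fun _ => (1 : ℝ)) ω * M.incr j (ω j i) -
      {ω | (i : ℕ∞) < δ.T ω}.indicator (fun _ => (1 : ℝ)) ω * M.incr k (ω k i)) (M.law A) :=
    fun i _ => (hM.integrable_indicator_mul_incr A j i hjint (hH i)).sub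
      (hM.integrable_indicator_mul_incr A k i hkint (hH i))
  rw [integral_finsetSum _ hint, Finset.sum_mul]
  refine Finset.sum_congr rfl fun i _ => ?_
  rw [integral_sub (hM.integrable_indicator_mul_incr A j i hjint (hH i))
      (hM.integrable_indicator_mul_incr A k i hkint (hH i)),
    hM.setIntegral_incr A j i (δ.measurableSet_lt i),
    hM.setIntegral_incr A k i (δ.measurableSet_lt i), hj1, hk1]
  ring

/-- The indicators of `i < T` with `i < N` add up to `min T N`. -/
lemma sum_law_lt_le_expT (δ : M.Procedure) (A : Finset (Fin J)) (hT : M.expT A δ ≠ ∞) (N : ℕ) :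
    ∑ i ∈ Finset.range N, (M.law A).real {ω | (i : ℕ∞) < δ.T ω} ≤ (M.expT A δ).toReal := by
  have hH := fun i => M.filt.le i _ (δ.measurableSet_lt i)
  have h1 : ∑ i ∈ Finset.range N, M.law A {ω | (i : ℕ∞) < δ.T ω} ≤ M.expT A δ := by
    calc _ = ∫⁻ ω, ∑ i ∈ Finset.range N,
          {ω | (i : ℕ∞) < δ.T ω}.indicator (fun _ => (1 : ℝ≥0∞)) ω ∂(M.law A) := by
          rw [lintegral_finsetSum _ fun i _ => measurable_const.indicator (hH i)]
          refine Finset.sum_congr rfl fun i _ => ?_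
          rw [lintegral_indicator_const (hH i), one_mul]
      _ ≤ _ := by
          refine lintegral_mono fun ω => ?_
          simp only [Set.indicator_apply, Set.mem_ofPred_eq, Finset.sum_boole]
          rcases eq_or_ne (δ.T ω) ⊤ with h | h
          · simp [h]
          · obtain ⟨n, hn⟩ := ENat.ne_top_iff_exists.1 h
            rw [← hn, ENat.toENNReal_coe]
            have : (Finset.filter (fun i : ℕ => (i : ℕ∞) < (n : ℕ∞)) (Finset.range N)) ⊆
                Finset.range n := fun i hi => by
              rw [Finset.mem_filter] at hi
              exact Finset.mem_range.2 (by exact_mod_cast hi.2)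
            have h2 := Finset.card_le_card this
            rw [Finset.card_range] at h2
            exact_mod_cast h2
  simp only [measureReal_def]
  rw [← ENNReal.toReal_sum (fun i _ => measure_ne_top _ _)]
  exact ENNReal.toReal_mono hT h1

/-! ### A lower bound for the expected sample size -/

/-- The decision time truncated at the horizon `N`. -/
noncomputable def Procedure.truncT (δ : M.Procedure) (N : ℕ) (ω : M.Path) : ℕ :=
  (min (δ.T ω) N).toNat

lemma Procedure.coe_truncT (δ : M.Procedure) (N : ℕ) (ω : M.Path) :
    (δ.truncT N ω : ℕ∞) = min (δ.T ω) N :=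
  ENat.natCast_toNat (ne_top_of_le_ne_top (ENat.natCast_ne_top N) (min_le_right _ _))

lemma Procedure.truncT_le (δ : M.Procedure) (N : ℕ) (ω : M.Path) : δ.truncT N ω ≤ N := by
  have : (δ.truncT N ω : ℕ∞) ≤ N := (δ.coe_truncT N ω).trans_le (min_le_right _ _)
  exact_mod_cast this

/-- Before the horizon truncation changes nothing. At the horizon the event is `T ≥ N`, still
decided at time `N`. Later values do not occur. -/
lemma Procedure.measurableSet_truncT_eq (δ : M.Procedure) (N n : ℕ) :
    MeasurableSet[M.filt n] {ω | δ.truncT N ω = n} := by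
  have key : ∀ ω, δ.truncT N ω = n ↔ min (δ.T ω) N = n := fun ω => by
    rw [← δ.coe_truncT N ω]; exact Nat.cast_inj.symm
  rcases lt_trichotomy n N with h | h | h
  · have : {ω | δ.truncT N ω = n} = {ω | δ.T ω = n} := by
      ext ω
      simp only [Set.mem_ofPred_eq, key]
      have h' : (n : ℕ∞) < N := by exact_mod_cast h
      rcases le_total (δ.T ω) N with h1 | h1
      · rw [min_eq_left h1]
      · rw [min_eq_right h1]
        exact ⟨fun h2 => absurd h2 h'.ne', fun h2 => absurd (h2 ▸ h1) (not_le.2 h')⟩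
    rw [this]
    exact δ.isStoppingTime.measurableSet_eq n
  · subst h
    have : {ω | δ.truncT n ω = n} = {ω | (n : ℕ∞) ≤ δ.T ω} := by
      ext ω
      simp only [Set.mem_ofPred_eq, key, min_eq_right_iff]
    rw [this]
    exact δ.isStoppingTime.measurableSet_ge n
  · have : {ω | δ.truncT N ω = n} = ∅ := by
      ext ω
      have := δ.truncT_le N ω
      simp only [Set.mem_ofPred_eq, Set.mem_empty_iff_false, iff_false]
      omega
    rw [this]
    exact @MeasurableSet.empty _ (M.filt n)

lemma Procedure.measurableSet_D_eq_inter (δ : M.Procedure) (A : Finset (Fin J)) (n : ℕ) :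
    MeasurableSet[M.filt n] ({ω | δ.D ω = A} ∩ {ω | δ.T ω ≤ (n : ℕ∞)}) := by
  have : MeasurableSet[δ.isStoppingTime.measurableSpace] {ω | δ.D ω = A} := by
    have h : {ω | δ.D ω = A} = ⋂ j, {ω | j ∈ δ.D ω ↔ j ∈ A} := by
      ext ω
      simp only [Set.mem_ofPred_eq, Set.mem_iInter, Finset.ext_iff]
    rw [h]
    refine MeasurableSet.iInter fun j => ?_
    by_cases hj : j ∈ A
    · simpa only [hj, iff_true] using δ.measurable_D j
    · simp only [hj, iff_false]
      exact (δ.measurable_D j).compl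
  exact this.2 n

lemma IsIID.stoppedDiff_ae_eq (hM : M.IsIID) (A : Finset (Fin J)) (j k : Fin J)
    (δ : M.Procedure) (N : ℕ) : ∀ᵐ ω ∂(M.law A),
      M.stoppedDiff δ j k N ω = M.lam j (δ.truncT N ω) ω - M.lam k (δ.truncT N ω) ω := by
  -- One exceptional null set for all times, since `n` is about to be replaced by a random time.
  have h : ∀ l, ∀ᵐ ω ∂(M.law A), ∀ n,
      M.lam l n ω = ∑ i ∈ Finset.range n, M.incr l (ω l i) := fun l =>
    ae_all_iff.2 fun n => M.ae_law_of_marg A l (hM.streamLLR_ae_eq A l n)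
  filter_upwards [h j, h k] with ω hj hk
  rw [hj, hk, ← Finset.sum_sub_distrib, stoppedDiff]
  have hsub : Finset.range (δ.truncT N ω) ⊆ Finset.range N :=
    Finset.range_subset_range.2 (δ.truncT_le N ω)
  have hiff : ∀ i < N, i < δ.truncT N ω ↔ (i : ℕ∞) < δ.T ω := fun i hi => by
    rw [← Nat.cast_lt (α := ℕ∞), δ.coe_truncT, lt_min_iff]
    exact and_iff_left (by exact_mod_cast hi)
  rw [← Finset.sum_subset hsub]
  · refine Finset.sum_congr rfl fun i hi => ?_
    have h1 := Finset.mem_range.1 hi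
    rw [Set.indicator_of_mem, one_mul]
    exact (hiff i (h1.trans_le (δ.truncT_le N ω))).1 h1
  · intro i hi hni
    rw [Set.indicator_of_notMem, zero_mul]
    rw [Finset.mem_range] at hi hni
    exact fun h => hni ((hiff i hi).2 h)

/-- Information bound on a finite horizon. -/
lemma IsIID.log_mul_law_le (hM : M.IsIID) {A : Finset (Fin J)} {j k : Fin J} (hj : j ∈ A)
    (hk : k ∉ A) (hjint : Integrable (fun x => M.incr j (x 0)) (M.marg A j))
    (hkint : Integrable (fun x => M.incr k (x 0)) (M.marg A k))
    (hinfo : 0 ≤ M.info₁ j + M.info₀ k) (δ : M.Procedure)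
    (hT : M.expT A δ ≠ ∞) {q : ℝ} (hq : 0 < q)
    (hQ : (M.law (insert k (A.erase j))).real {ω | δ.D ω = A} ≤ q) (N : ℕ) :
    Real.log q⁻¹ * (M.law A).real ({ω | δ.D ω = A} ∩ {ω | δ.T ω ≤ (N : ℕ∞)}) - 1 ≤
      (M.info₁ j + M.info₀ k) * (M.expT A δ).toReal := by
  set A' := insert k (A.erase j)
  set G : Set M.Path := {ω | δ.D ω = A} ∩ {ω | δ.T ω ≤ (N : ℕ∞)}
  set τ := δ.truncT N
  set Z := M.stoppedDiff δ j k N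
  set a := Real.log q⁻¹
  have hGm : MeasurableSet G := M.filt.le N _ (δ.measurableSet_D_eq_inter A N)
  have hGτ : ∀ n, MeasurableSet[M.filt n] (G ∩ {ω | τ ω = n}) := by
    intro n
    have : G ∩ {ω | τ ω = n} = ({ω | δ.D ω = A} ∩ {ω | δ.T ω ≤ (n : ℕ∞)}) ∩ {ω | τ ω = n} := by
      ext ω
      simp only [G, Set.mem_inter_iff, Set.mem_ofPred_eq]
      constructor
      · rintro ⟨⟨h1, h2⟩, h3⟩
        refine ⟨⟨h1, ?_⟩, h3⟩
        rw [← h3, δ.coe_truncT, min_eq_left h2]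
      · rintro ⟨⟨h1, h2⟩, h3⟩
        refine ⟨⟨h1, h2.trans ?_⟩, h3⟩
        rw [← h3]
        exact_mod_cast δ.truncT_le N ω
    rw [this]
    exact (δ.measurableSet_D_eq_inter A n).inter (δ.measurableSet_truncT_eq N n)
  have hGcτ : ∀ n, MeasurableSet[M.filt n] (Gᶜ ∩ {ω | τ ω = n}) := by
    intro n
    have : Gᶜ ∩ {ω | τ ω = n} = {ω | τ ω = n} \ (G ∩ {ω | τ ω = n}) := by
      ext ω
      simp only [Set.mem_inter_iff, Set.mem_compl_iff, Set.mem_sdiff]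
      tauto
    rw [this]
    exact (δ.measurableSet_truncT_eq N n).diff (hGτ n)
  have hZ : ∀ᵐ ω ∂(M.law A), -Z ω = M.setLLR A A' (τ ω) ω := by
    filter_upwards [hM.stoppedDiff_ae_eq A j k δ N] with ω hω
    rw [M.setLLR_swap hj hk, ← hω]
  have hcm : ∀ H : Set M.Path, (∀ n, MeasurableSet[M.filt n] (H ∩ {ω | τ ω = n})) →
      ∫⁻ ω in H, ENNReal.ofReal (Real.exp (-Z ω)) ∂(M.law A) = M.law A' H := by
    intro H hH
    rw [← M.setLIntegral_exp_setLLR_stopped A A' τ hH]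
    refine lintegral_congr_ae (ae_restrict_of_ae ?_)
    filter_upwards [hZ] with ω hω
    rw [hω]
  set g : M.Path → ℝ := G.indicator fun _ => a
  have hgm : Measurable g := measurable_const.indicator hGm
  have hZm : Measurable Z := M.measurable_stoppedDiff δ j k N
  -- The Gibbs variational inequality with test function `log q⁻¹` on `G`. As `exp (-Z)` is the
  -- density of the swapped law at `τ`, the integral is `q⁻¹ P_{A'}(G) + P_{A'}(Gᶜ) ≤ 1 + 1`.
  have hL : ∫⁻ ω, ENNReal.ofReal (Real.exp (g ω - Z ω)) ∂(M.law A) ≤ ENNReal.ofReal 2 := by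
    rw [← lintegral_add_compl _ hGm]
    have h1 : ∫⁻ ω in G, ENNReal.ofReal (Real.exp (g ω - Z ω)) ∂(M.law A) =
        ENNReal.ofReal q⁻¹ * M.law A' G := by
      rw [← hcm G hGτ, ← lintegral_const_mul _ (by fun_prop)]
      refine setLIntegral_congr_fun hGm fun ω hω => ?_
      have : g ω = a := Set.indicator_of_mem hω _
      rw [this, sub_eq_add_neg, Real.exp_add, Real.exp_log (inv_pos.2 hq),
        ENNReal.ofReal_mul (inv_pos.2 hq).le]
    have h2 : ∫⁻ ω in Gᶜ, ENNReal.ofReal (Real.exp (g ω - Z ω)) ∂(M.law A) = M.law A' Gᶜ := by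
      rw [← hcm Gᶜ hGcτ]
      refine setLIntegral_congr_fun hGm.compl fun ω hω => ?_
      have : g ω = 0 := Set.indicator_of_notMem hω _
      rw [this, zero_sub]
    have h3 : M.law A' G ≤ ENNReal.ofReal q := by
      refine (measure_mono Set.inter_subset_left).trans ?_
      rw [← ofReal_measureReal]
      exact ENNReal.ofReal_le_ofReal hQ
    rw [h1, h2]
    calc _ ≤ ENNReal.ofReal q⁻¹ * ENNReal.ofReal q + 1 := by gcongr; exact prob_le_one
      _ = ENNReal.ofReal 2 := by
        rw [← ENNReal.ofReal_mul (inv_pos.2 hq).le, inv_mul_cancel₀ hq.ne', ← ENNReal.ofReal_one,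
          ← ENNReal.ofReal_add zero_le_one zero_le_one]
        norm_num
  have hem : Measurable fun ω => Real.exp (g ω - Z ω) := by fun_prop
  have hei : Integrable (fun ω => Real.exp (g ω - Z ω)) (M.law A) := by
    refine ⟨hem.aestronglyMeasurable, ?_⟩
    rw [hasFiniteIntegral_iff_ofReal (ae_of_all _ fun _ => (Real.exp_pos _).le)]
    exact hL.trans_lt ENNReal.ofReal_lt_top
  have he2 : ∫ ω, Real.exp (g ω - Z ω) ∂(M.law A) ≤ 2 := by
    rw [integral_eq_lintegral_of_nonneg_ae (ae_of_all _ fun _ => (Real.exp_pos _).le)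
      hem.aestronglyMeasurable]
    exact ENNReal.toReal_le_of_le_ofReal zero_le_two hL
  have hgi : Integrable g (M.law A) := (integrable_const a).indicator hGm
  have hZi : Integrable Z (M.law A) := hM.integrable_stoppedDiff hjint hkint δ N
  have hgZ : Integrable (fun ω => g ω - Z ω) (M.law A) := hgi.sub hZi
  -- With `x + 1 ≤ exp x` the mean of `g - Z` is at most `1`, the constant subtracted in the
  -- conclusion.
  have hmono : ∫ ω, (g ω - Z ω + 1) ∂(M.law A) ≤ ∫ ω, Real.exp (g ω - Z ω) ∂(M.law A) :=
    integral_mono (hgZ.add (integrable_const 1)) hei fun ω => Real.add_one_le_exp _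
  rw [integral_add hgZ (integrable_const 1), integral_sub hgi hZi,
    integral_indicator_const a hGm, integral_stoppedDiff hM hj hk hjint hkint δ N] at hmono
  simp only [integral_const, probReal_univ, smul_eq_mul] at hmono
  have hW := mul_le_mul_of_nonneg_right (sum_law_lt_le_expT δ A hT N) hinfo
  linarith

/-- Information bound for the expected sample size of a procedure. -/
lemma IsIID.log_mul_law_D_eq_le (hM : M.IsIID) {A : Finset (Fin J)} {j k : Fin J} (hj : j ∈ A)
    (hk : k ∉ A) (hjint : Integrable (fun x => M.incr j (x 0)) (M.marg A j))
    (hkint : Integrable (fun x => M.incr k (x 0)) (M.marg A k))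
    (hinfo : 0 ≤ M.info₁ j + M.info₀ k) (δ : M.Procedure)
    (hT : M.expT A δ ≠ ∞) {q : ℝ} (hq : 0 < q)
    (hQ : (M.law (insert k (A.erase j))).real {ω | δ.D ω = A} ≤ q) :
    Real.log q⁻¹ * (M.law A).real {ω | δ.D ω = A} - 1 ≤
      (M.info₁ j + M.info₀ k) * (M.expT A δ).toReal := by
  have hTm : Measurable fun ω => (δ.T ω : ℝ≥0∞) := by
    have h1 : Measurable δ.T := by
      refine measurable_to_countable' fun x => ?_
      induction x with
      | top =>
        have : δ.T ⁻¹' {⊤} = ⋂ n : ℕ, {ω | (n : ℕ∞) < δ.T ω} := by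
          ext ω
          simp [ENat.eq_top_iff_forall_gt]
        rw [this]
        exact .iInter fun n => M.filt.le n _ (δ.measurableSet_lt n)
      | coe n => exact M.filt.le n _ (δ.isStoppingTime.measurableSet_eq n)
    exact (measurable_from_top (f := fun x : ℕ∞ => (x : ℝ≥0∞))).comp h1
  have hfin : ∀ᵐ ω ∂(M.law A), δ.T ω ≠ ⊤ := by
    filter_upwards [ae_lt_top hTm hT] with ω hω h
    rw [h] at hω
    simp at hω
  -- The right side of the finite-horizon bound does not depend on `N`, and the restriction to `T ≤
  -- N` disappears in the limit because `T` is almost surely finite.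
  have hlim : Tendsto (fun N : ℕ => (M.law A).real ({ω | δ.D ω = A} ∩ {ω | δ.T ω ≤ (N : ℕ∞)}))
      atTop (𝓝 ((M.law A).real {ω | δ.D ω = A})) := by
    have hmono : Monotone fun N : ℕ => {ω | δ.D ω = A} ∩ {ω | δ.T ω ≤ (N : ℕ∞)} :=
      fun a b hab => Set.inter_subset_inter_right _ fun ω hω =>
        le_trans (show δ.T ω ≤ (a : ℕ∞) from hω) (by exact_mod_cast hab)
    have h1 := tendsto_measure_iUnion_atTop (μ := M.law A) hmono
    have h2 : M.law A (⋃ N : ℕ, {ω | δ.D ω = A} ∩ {ω | δ.T ω ≤ (N : ℕ∞)}) =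
        M.law A {ω | δ.D ω = A} := by
      refine measure_congr ?_
      filter_upwards [hfin] with ω hω
      obtain ⟨n, hn⟩ := ENat.ne_top_iff_exists.1 hω
      refine propext ⟨fun h => ?_, fun h => ?_⟩
      · obtain ⟨N, hN⟩ := Set.mem_iUnion.1 h
        exact hN.1
      · exact Set.mem_iUnion.2 ⟨n, h, hn.symm.le⟩
    rw [h2] at h1
    exact (ENNReal.tendsto_toReal (measure_ne_top _ _)).comp h1
  exact le_of_tendsto' ((hlim.const_mul _).sub_const 1) fun N =>
    hM.log_mul_law_le hj hk hjint hkint hinfo δ hT hq hQ N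

/-- Nonasymptotic lower bound for the expected sample size of a controlling procedure. -/
lemma IsIID.le_expT_of_mem_controlling (hM : M.IsIID) {m : ℕ} {A : Finset (Fin J)}
    (hA : A.card = m) {j k : Fin J} (hj : j ∈ A)
    (hk : k ∉ A) (hjint : Integrable (fun x => M.incr j (x 0)) (M.P₁ j))
    (hkint : Integrable (fun x => M.incr k (x 0)) (M.P₀ k))
    (hinfo : 0 ≤ M.info₁ j + M.info₀ k) {E : M.ErrorMetric} {C₂ : ℝ} (hC : 0 < C₂)
    (hE : E.LowerBound m C₂) {a b : ℝ} (hab : 0 < min a b) (hab' : min a b ≤ C₂)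
    {δ : M.Procedure} (hδ : δ ∈ E.controlling (exactClass J m) a b)
    (hT : M.expT A δ ≠ ∞) :
    Real.log (min a b / C₂)⁻¹ * (1 - 2 * (max a b / C₂)) - 1 ≤
      (M.info₁ j + M.info₀ k) * (M.expT A δ).toReal := by
  have hfwe : ∀ S : Finset (Fin J), S.card = m →
      M.fwe₁ S δ ≤ a / C₂ ∧ M.fwe₂ S δ ≤ b / C₂ := fun S hS => by
    rw [le_div_iff₀' hC, le_div_iff₀' hC]
    exact ⟨((hE S hS δ).1.trans (hδ S hS).1), ((hE S hS δ).2.trans (hδ S hS).2)⟩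
  set A' := insert k (A.erase j) with hA'
  have hjk : j ≠ k := fun h => hk (h ▸ hj)
  have hjA' : j ∉ A' := by simp [hA', hjk]
  have hkA' : k ∈ A' := Finset.mem_insert_self _ _
  -- Under `A'` the decision `A` wrongly includes `j` and wrongly omits `k`. Both levels apply,
  -- which is where `min a b` comes from.
  have hQ : (M.law A').real {ω | δ.D ω = A} ≤ min a b / C₂ := by
    obtain ⟨h1, h2⟩ := hfwe A' ((card_swap hj hk).trans hA)
    rw [← min_div_div_right hC.le]
    refine le_min (le_trans (measureReal_mono fun ω hω => ?_) h1)
      (le_trans (measureReal_mono fun ω hω => ?_) h2)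
    · change δ.D ω = A at hω
      exact Finset.card_pos.2 ⟨j, by rw [hω, Finset.mem_sdiff]; exact ⟨hj, hjA'⟩⟩
    · change δ.D ω = A at hω
      exact Finset.card_pos.2 ⟨k, by rw [hω, Finset.mem_sdiff]; exact ⟨hkA', hk⟩⟩
  have hP : 1 - 2 * (max a b / C₂) ≤ (M.law A).real {ω | δ.D ω = A} := by
    obtain ⟨h1, h2⟩ := hfwe A hA
    have hcov : (Set.univ : Set M.Path) ⊆ {ω | δ.D ω = A} ∪
        ({ω | 1 ≤ (δ.D ω \ A).card} ∪ {ω | 1 ≤ (A \ δ.D ω).card}) := by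
      intro ω _
      by_contra h
      simp only [Set.mem_union, Set.mem_ofPred_eq, not_or, not_le, Nat.lt_one_iff,
        Finset.card_eq_zero, Finset.sdiff_eq_empty_iff_subset] at h
      exact h.1 (Finset.Subset.antisymm h.2.1 h.2.2)
    have h3 : (1 : ℝ) ≤ (M.law A).real {ω | δ.D ω = A} + (M.fwe₁ A δ + M.fwe₂ A δ) := by
      calc (1 : ℝ) = (M.law A).real Set.univ := probReal_univ.symm
        _ ≤ _ := measureReal_mono hcov
        _ ≤ _ := measureReal_union_le _ _
        _ ≤ _ := by gcongr; exact measureReal_union_le _ _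
    have h4 : a / C₂ ≤ max a b / C₂ := by gcongr; exact le_max_left _ _
    have h5 : b / C₂ ≤ max a b / C₂ := by gcongr; exact le_max_right _ _
    linarith
  have hq : 0 < min a b / C₂ := div_pos hab hC
  have hlog : 0 ≤ Real.log (min a b / C₂)⁻¹ :=
    Real.log_nonneg ((one_le_inv₀ hq).2 ((div_le_one hC).2 hab'))
  have hmain := hM.log_mul_law_D_eq_le hj hk (by rwa [marg, if_pos hj])
    (by rwa [marg, if_neg hk]) hinfo δ hT hq hQ
  have := mul_le_mul_of_nonneg_left hP hlog
  linarith

end StreamModel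

/-! ### Asymptotics -/

section Asymptotics

lemma tendsto_abs_log_min {ι : Type*} {l : Filter ι} {α β : ι → ℝ} (hα : Tendsto α l (𝓝 0))
    (hβ : Tendsto β l (𝓝 0)) (hα0 : ∀ᶠ i in l, 0 < α i) (hβ0 : ∀ᶠ i in l, 0 < β i) :
    Tendsto (fun i => |Real.log (min (α i) (β i))|) l atTop := by
  have h1 : Tendsto (fun i => min (α i) (β i)) l (𝓝[>] 0) := by
    refine tendsto_nhdsWithin_iff.2 ⟨by simpa using hα.min hβ, ?_⟩
    filter_upwards [hα0, hβ0] with i h1 h2 using lt_min h1 h2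
  exact tendsto_abs_atBot_atTop.comp (Real.tendsto_log_nhdsGT_zero.comp h1)

lemma abs_log_min_eq {a b : ℝ} (ha : 0 < a) (hb : 0 < b) (h : min a b ≤ 1) :
    |Real.log (min a b)| = -Real.log (min a b) :=
  abs_of_nonpos (Real.log_nonpos (lt_min ha hb).le h)

/-- Since `1 ≤ m (J - m) ≤ J ^ 2`, the combinatorial term is between `0` and `2 log J`; the crude
`log J ≤ J` is enough because `J` is negligible against `|log (min a b)|` where this is applied. -/
lemma gapThreshold_bounds {J m : ℕ} (hm : 1 ≤ m ∧ m < J) {C₁ a b : ℝ} (hC : 0 < C₁)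
    (ha : 0 < a) (hb : 0 < b) :
    |Real.log (min a b)| - |Real.log C₁| ≤ gapThreshold J m C₁ a b ∧
      gapThreshold J m C₁ a b ≤ |Real.log (min a b)| + |Real.log C₁| + 2 * J := by
  have hm1 : (1 : ℝ) ≤ m := by exact_mod_cast hm.1
  have hmJ : (1 : ℝ) ≤ (J : ℝ) - m := by
    have : (m : ℝ) + 1 ≤ J := by exact_mod_cast hm.2
    linarith
  have h1 : 1 ≤ (m : ℝ) * ((J : ℝ) - m) := one_le_mul_of_one_le_of_one_le hm1 hmJ
  have hJ0 : (0 : ℝ) < J := by linarith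
  have h2 : Real.log ((m : ℝ) * ((J : ℝ) - m)) ≤ 2 * J := by
    calc Real.log ((m : ℝ) * ((J : ℝ) - m)) ≤ Real.log ((J : ℝ) * J) :=
          Real.log_le_log (by linarith) (by nlinarith)
      _ = Real.log J + Real.log J := Real.log_mul hJ0.ne' hJ0.ne'
      _ ≤ 2 * J := by linarith [Real.log_le_self hJ0.le]
  have h3 := Real.log_nonneg h1
  have h4 : Real.log (min (a / C₁) (b / C₁)) = Real.log (min a b) - Real.log C₁ := by
    rw [min_div_div_right hC.le, Real.log_div (lt_min ha hb).ne' hC.ne']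
  rw [gapThreshold, h4]
  have h5 := abs_sub (Real.log (min a b)) (Real.log C₁)
  have h6 := abs_sub_abs_le_abs_sub (Real.log (min a b)) (Real.log C₁)
  constructor <;> linarith

lemma isEquivalent_of_eventually_between {ι : Type*} {l : Filter ι} {u w : ι → ℝ}
    (h : ∀ ε : ℝ, 0 < ε → ε ≤ 1 → ∀ᶠ i in l, 0 ≤ w i ∧ (1 - ε) * w i ≤ u i ∧
      u i ≤ (1 + ε) * w i) : u ~[l] w := by
  refine isLittleO_iff.2 fun c hc => ?_
  filter_upwards [h (min c 1) (lt_min hc one_pos) (min_le_right _ _)] with i hi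
  obtain ⟨h0, h1, h2⟩ := hi
  have h3 : min c 1 * w i ≤ c * w i := mul_le_mul_of_nonneg_right (min_le_left _ _) h0
  rw [Pi.sub_apply, Real.norm_eq_abs, Real.norm_eq_abs, abs_of_nonneg h0, abs_le]
  constructor <;> linarith

end Asymptotics

namespace StreamModel

/-- Asymptotic optimality of the gap rule along an arbitrary filter, when the truncated means
approach the minimal information numbers uniformly. -/
theorem gapRule_isEquivalent {ι : Type*} {l : Filter ι} {α β : ι → ℝ} {J m : ι → ℕ}
    (hm : ∀ i, 1 ≤ m i ∧ m i < J i) {M : ∀ i, StreamModel.{u} (J i)}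
    {E : ∀ i, (M i).ErrorMetric} {C₁ C₂ : ι → ℝ} {A : ∀ i, Finset (Fin (J i))}
    (hα0 : ∀ᶠ i in l, 0 < α i) (hβ0 : ∀ᶠ i in l, 0 < β i)
    (hC₁ : ∀ i, 0 < C₁ i) (hC₂ : ∀ i, 0 < C₂ i)
    (hU : ∀ i, (E i).UpperBound (m i) (hm i) (C₁ i)) (hL : ∀ i, (E i).LowerBound (m i) (C₂ i))
    (hα : Tendsto α l (𝓝 0)) (hβ : Tendsto β l (𝓝 0))
    (hJ : (fun i => (J i : ℝ)) =o[l] fun i => |Real.log (min (α i) (β i))|)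
    (hlog₁ : (fun i => Real.log (C₁ i)) =o[l] fun i => |Real.log (min (α i) (β i))|)
    (hlog₂ : (fun i => Real.log (C₂ i)⁻¹) =o[l] fun i => |Real.log (min (α i) (β i))|)
    (hmax : Tendsto (fun i => max (α i) (β i) / C₂ i) l (𝓝 0))
    (hM : ∀ i, (M i).IsIID) {r : ℝ} (hr : 0 < r)
    (hinfo : ∀ i j, r ≤ (M i).info₀ j ∧ r ≤ (M i).info₁ j)
    (hint₀ : ∀ i j, Integrable (fun x => (M i).incr j (x 0)) ((M i).P₀ j))
    (hint₁ : ∀ i j, Integrable (fun x => (M i).incr j (x 0)) ((M i).P₁ j))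
    (hA : ∀ i, (A i).card = m i) {K : ℝ} (hK : ∀ i, (M i).eta₁ (A i) + (M i).eta₀ (A i) ≤ K)
    (htrunc : ∀ ε : ℝ, 0 < ε → ∃ B : ℝ, 0 ≤ B ∧ ∀ i,
      (∀ j ∈ A i, (M i).eta₁ (A i) - ε ≤ ∫ x, min ((M i).incr j (x 0)) B ∂((M i).P₁ j)) ∧
      (∀ j ∉ A i, (M i).eta₀ (A i) - ε ≤ ∫ x, min (-(M i).incr j (x 0)) B ∂((M i).P₀ j))) :
    (∀ᶠ i in l, (M i).expT (A i) ((M i).gapRule (m i) (hm i)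
      (gapThreshold (J i) (m i) (C₁ i) (α i) (β i))) ≠ ∞) ∧
    (fun i => ((M i).expT (A i) ((M i).gapRule (m i) (hm i)
        (gapThreshold (J i) (m i) (C₁ i) (α i) (β i)))).toReal)
      ~[l] (fun i => |Real.log (min (α i) (β i))| / ((M i).eta₁ (A i) + (M i).eta₀ (A i))) ∧
    (fun i => |Real.log (min (α i) (β i))| / ((M i).eta₁ (A i) + (M i).eta₀ (A i)))
      ~[l] (fun i => (⨅ δ ∈ (E i).controlling (exactClass (J i) (m i)) (α i) (β i),
        (M i).expT (A i) δ).toReal) := by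
  set L : ι → ℝ := fun i => |Real.log (min (α i) (β i))| with hLdef
  set η : ι → ℝ := fun i => (M i).eta₁ (A i) + (M i).eta₀ (A i) with hηdef
  set c : ι → ℝ := fun i => gapThreshold (J i) (m i) (C₁ i) (α i) (β i) with hcdef
  set U : ι → ℝ≥0∞ := fun i => (M i).expT (A i) ((M i).gapRule (m i) (hm i) (c i)) with hUdef
  set V : ι → ℝ≥0∞ := fun i => ⨅ δ ∈ (E i).controlling (exactClass (J i) (m i)) (α i) (β i),
    (M i).expT (A i) δ with hVdef
  have hLtop : Tendsto L l atTop := tendsto_abs_log_min hα hβ hα0 hβ0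
  have hη2 : ∀ i, 2 * r ≤ η i := fun i => by
    obtain ⟨j, -, hj⟩ := (M i).exists_eta₁_eq (hm i) (hA i)
    obtain ⟨k, -, hk⟩ := (M i).exists_eta₀_eq (hm i) (hA i)
    have h1 := (hinfo i j).2
    have h2 := (hinfo i k).1
    simp only [hηdef, hj, hk]
    linarith
  have hη0 : ∀ i, 0 < η i := fun i => by linarith [hη2 i]
  have hlog₁' : ∀ ε : ℝ, 0 < ε → ∀ᶠ i in l, |Real.log (C₁ i)| ≤ ε * L i := fun ε hε => by
    filter_upwards [hlog₁.bound hε] with i hi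
    simpa [L] using hi
  have hlog₂' : ∀ ε : ℝ, 0 < ε → ∀ᶠ i in l, Real.log (C₂ i)⁻¹ ≤ ε * L i := fun ε hε => by
    filter_upwards [hlog₂.bound hε] with i hi
    refine (le_abs_self _).trans ?_
    rw [Real.norm_eq_abs, Real.norm_eq_abs, abs_abs] at hi
    exact hi
  have hJ' : ∀ ε : ℝ, 0 < ε → ∀ᶠ i in l, (J i : ℝ) ≤ ε * L i := fun ε hε => by
    filter_upwards [hJ.bound hε] with i hi
    simpa [L] using hi
  have hcpos : ∀ᶠ i in l, 0 < c i := by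
    filter_upwards [hα0, hβ0, hlog₁' (1 / 2) one_half_pos, hLtop.eventually_gt_atTop 0]
      with i h1 h2 h3 h4
    have := (gapThreshold_bounds (hm i) (hC₁ i) h1 h2).1
    simp only [L, c] at *
    linarith
  have hVU : ∀ᶠ i in l, V i ≤ U i := by
    filter_upwards [hα0, hβ0, hcpos] with i h1 h2 h3
    exact iInf₂_le _ ((M i).gapRule_mem_controlling (hm i) (hC₁ i) (hU i) h1 h2 h3)
  have hupper : ∀ ε : ℝ, 0 < ε → ε ≤ 1 → ∀ᶠ i in l,
      U i ≤ ENNReal.ofReal ((1 + ε) * (L i / η i)) := by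
    intro ε hε hε1
    -- The deviation bound asks for `e ≤ 8`. The other term gives `4 e ≤ r ε / 4 ≤ η ε / 8`, because
    -- `η ≥ 2 r`.
    set e := min 8 (r * ε / 16) with he
    have he0 : 0 < e := lt_min (by norm_num) (by positivity)
    have her : e ≤ r * ε / 16 := min_le_right _ _
    obtain ⟨B, hB, hBt⟩ := htrunc e he0
    set κ := (1 - Real.exp (-(e ^ 2 / (4 * (B ^ 2 + 8)))))⁻¹ with hκ
    have hκ0 : 0 < κ := by
      rw [hκ, inv_pos, sub_pos, Real.exp_lt_one_iff, neg_lt_zero]; positivity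
    -- An upper bound on `η` keeps `L / η` at least `L / K'`, so that the summands `1` and `J κ` are
    -- each absorbed by `ε / 4` of the main term.
    set K' := max K 1 with hK'
    have hK'0 : 0 < K' := one_pos.trans_le (le_max_right _ _)
    filter_upwards [hα0, hβ0, hcpos, hlog₁' (ε / 16) (by positivity),
      hJ' (ε / 32) (by positivity), hJ' (ε / (4 * K' * κ)) (by positivity),
      hLtop.eventually_ge_atTop (4 * K' / ε)] with i h1 h2 h3 h4 h5 h6 h7
    have hηK : η i ≤ K' := (hK i).trans (le_max_left _ _)
    have hL0 : 0 < L i := (by positivity : 0 < 4 * K' / ε).trans_le h7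
    have hden : η i * (1 - ε / 8) ≤ η i - 4 * e := by
      have := mul_le_mul_of_nonneg_right (hη2 i) hε.le
      linarith
    have hden0 : 0 < η i * (1 - ε / 8) := mul_pos (hη0 i) (by linarith)
    have hbound := (hM i).expT_gapRule_le (hm i) (hA i) hB he0 (min_le_left _ _) h3
      (hBt i).1 (hBt i).2 (hden0.trans_le hden)
    refine hbound.trans (ENNReal.ofReal_le_ofReal ?_)
    have hc1 : c i ≤ (1 + ε / 8) * L i := by
      have := (gapThreshold_bounds (hm i) (hC₁ i) h1 h2).2
      simp only [L, c] at *
      linarith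
    have t1 : c i / (η i - 4 * e) ≤ (1 + ε / 2) * (L i / η i) := by
      calc c i / (η i - 4 * e) ≤ ((1 + ε / 8) * L i) / (η i * (1 - ε / 8)) := by gcongr
        _ = (1 + ε / 8) / (1 - ε / 8) * (L i / η i) := by
          rw [mul_comm (η i), mul_div_mul_comm]
        _ ≤ (1 + ε / 2) * (L i / η i) := by
          refine mul_le_mul_of_nonneg_right ?_ (div_nonneg hL0.le (hη0 i).le)
          rw [div_le_iff₀ (by linarith)]
          nlinarith
    have hLK : L i / K' ≤ L i / η i := div_le_div_of_nonneg_left hL0.le (hη0 i) hηK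
    have t2 : 1 ≤ ε / 4 * (L i / K') := by
      rw [div_le_iff₀ hε] at h7
      rw [div_mul_div_comm, le_div_iff₀ (by positivity)]
      linarith
    have t3 : (J i : ℝ) * κ ≤ ε / 4 * (L i / K') := by
      calc (J i : ℝ) * κ ≤ ε / (4 * K' * κ) * L i * κ := by gcongr
        _ = ε / 4 * (L i / K') := by field_simp
    have t4 := mul_le_mul_of_nonneg_left hLK (by positivity : 0 ≤ ε / 4)
    change c i / (η i - 4 * e) + 1 + J i * κ ≤ _
    linarith
  have hlower : ∀ ε : ℝ, 0 < ε → ε ≤ 1 → ∀ᶠ i in l,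
      ENNReal.ofReal ((1 - ε) * (L i / η i)) ≤ V i := by
    intro ε hε hε1
    filter_upwards [hα0, hβ0, hlog₂' (ε / 4) (by positivity),
      hLtop.eventually_ge_atTop (4 / ε), hmax.eventually_le_const (show (0 : ℝ) < ε / 8 by
        positivity), hα.eventually_le_const one_pos] with i h1 h2 h3 h4 h5 h6
    have hmin : 0 < min (α i) (β i) := lt_min h1 h2
    have hL0 : 0 < L i := (by positivity : 0 < 4 / ε).trans_le h4
    have hminC : min (α i) (β i) ≤ C₂ i := by
      rw [div_le_iff₀ (hC₂ i)] at h5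
      have := hC₂ i
      have h8 : min (α i) (β i) ≤ max (α i) (β i) := min_le_max
      nlinarith
    have hlogeq : Real.log (min (α i) (β i) / C₂ i)⁻¹ = L i - Real.log (C₂ i)⁻¹ := by
      have h7 : L i = -Real.log (min (α i) (β i)) :=
        abs_log_min_eq h1 h2 ((min_le_left _ _).trans h6)
      rw [Real.log_inv, Real.log_inv, Real.log_div hmin.ne' (hC₂ i).ne', h7]
      ring
    obtain ⟨j, hj, hjη⟩ := (M i).exists_eta₁_eq (hm i) (hA i)
    obtain ⟨k, hk, hkη⟩ := (M i).exists_eta₀_eq (hm i) (hA i)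
    have hηjk : (M i).info₁ j + (M i).info₀ k = η i := by simp only [hηdef, hjη, hkη]
    refine le_iInf₂ fun δ hδ => ?_
    rcases eq_or_ne ((M i).expT (A i) δ) ∞ with hT | hT
    · rw [hT]; exact le_top
    have hb := (hM i).le_expT_of_mem_controlling (hA i) hj hk (hint₁ i j) (hint₀ i k)
      (by rw [hηjk]; exact (hη0 i).le) (hC₂ i) (hL i) hmin hminC hδ hT
    rw [hηjk, hlogeq] at hb
    refine (ENNReal.ofReal_le_iff_le_toReal hT).2 ?_
    rw [mul_div_assoc', div_le_iff₀' (hη0 i)]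
    refine le_trans ?_ hb
    have s1 : 1 ≤ ε / 4 * L i := by
      rw [div_le_iff₀ hε] at h4
      linarith
    -- Three losses of a relative size at most `ε / 4`: from `C₂`, from the probability of a wrong
    -- decision, and from the subtracted `1` in `s1`.
    have s2 : (1 - ε / 4) * L i * (1 - ε / 4) ≤
        (L i - Real.log (C₂ i)⁻¹) * (1 - 2 * (max (α i) (β i) / C₂ i)) := by
      have : 0 ≤ (1 - ε / 4) * L i := mul_nonneg (by linarith) hL0.le
      refine mul_le_mul (by linarith) (by linarith) (by linarith) (by linarith)
    nlinarith [mul_nonneg (sq_nonneg ε) hL0.le]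
  -- Needed before passing to real numbers, since `toReal` sends `∞` to `0`.
  have hUtop : ∀ᶠ i in l, U i ≠ ∞ := by
    filter_upwards [hupper 1 one_pos le_rfl] with i hi
    exact ne_top_of_le_ne_top ENNReal.ofReal_ne_top hi
  have hW : ∀ i, 0 ≤ L i / η i := fun i => div_nonneg (abs_nonneg _) (hη0 i).le
  -- The gap rule is itself a competitor in the infimum, so one chain of inequalities squeezes both
  -- quantities.
  have hall : ∀ ε : ℝ, 0 < ε → ε ≤ 1 → ∀ᶠ i in l, (1 - ε) * (L i / η i) ≤ (V i).toReal ∧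
      (V i).toReal ≤ (U i).toReal ∧ (U i).toReal ≤ (1 + ε) * (L i / η i) := by
    intro ε hε hε1
    filter_upwards [hupper ε hε hε1, hlower ε hε hε1, hVU, hUtop] with i h1 h2 h3 h4
    refine ⟨(ENNReal.ofReal_le_iff_le_toReal (ne_top_of_le_ne_top h4 h3)).1 h2,
      ENNReal.toReal_mono h4 h3, ENNReal.toReal_le_of_le_ofReal ?_ h1⟩
    exact mul_nonneg (by linarith) (hW i)
  refine ⟨hUtop, isEquivalent_of_eventually_between fun ε hε hε1 => ?_,
    (isEquivalent_of_eventually_between fun ε hε hε1 => ?_).symm⟩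
  · filter_upwards [hall ε hε hε1] with i hi
    exact ⟨hW i, hi.1.trans hi.2.1, hi.2.2⟩
  · filter_upwards [hall ε hε hε1] with i hi
    exact ⟨hW i, hi.1, hi.2.1.trans hi.2.2⟩

/-! ### Integrability and truncation levels for the information numbers -/

variable {J : ℕ} {M : StreamModel.{u} J}

lemma IsIID.integrable_incr₁ (hM : M.IsIID) {j : Fin J}
    (h : Integrable (streamLLR (M.P₀ j) (M.P₁ j) 1) (M.P₁ j)) :
    Integrable (fun x => M.incr j (x 0)) (M.P₁ j) :=
  h.congr (hM.streamLLR_one_ae_eq₁ j)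

lemma IsIID.integrable_incr₀ (hM : M.IsIID) {j : Fin J}
    (h : Integrable (streamLLR (M.P₀ j) (M.P₁ j) 1) (M.P₀ j)) :
    Integrable (fun x => M.incr j (x 0)) (M.P₀ j) :=
  h.congr (hM.streamLLR_one_ae_eq₀ j)

/-- The integral of a nonintegrable function is `0` by convention, so a positive information number
is automatically finite. -/
lemma integrable_of_info₁_pos {j : Fin J} (h : 0 < M.info₁ j) :
    Integrable (streamLLR (M.P₀ j) (M.P₁ j) 1) (M.P₁ j) :=
  Integrable.of_integral_ne_zero h.ne'

lemma integrable_of_info₀_pos {j : Fin J} (h : 0 < M.info₀ j) :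
    Integrable (streamLLR (M.P₀ j) (M.P₁ j) 1) (M.P₀ j) :=
  integrable_neg_iff.1 (Integrable.of_integral_ne_zero h.ne')

lemma sub_div_four_mul_le {a ε K B : ℝ} (hε : 0 < ε) (haB : a < B) (h : a + K / (4 * ε) ≤ B) :
    a - ε ≤ a - K / (4 * (B - a)) := by
  have h1 : K / (4 * ε) ≤ B - a := by linarith
  rw [div_le_iff₀ (by positivity)] at h1
  have h2 : K / (4 * (B - a)) ≤ ε := by
    rw [div_le_iff₀ (by linarith)]; linarith
  linarith

/-- With bounded variances the truncated means approach the information numbers uniformly. -/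
lemma IsIID.sub_le_integral_min_incr (hM : M.IsIID) {A : Finset (Fin J)} {Kv : NNReal}
    (hv : ∀ j, M.var₀ j ≤ Kv ∧ M.var₁ j ≤ Kv) {ε B : ℝ} (hε : 0 < ε)
    (hB₁ : M.eta₁ A + Kv / (4 * ε) < B) (hB₀ : M.eta₀ A + Kv / (4 * ε) < B) :
    (∀ j ∈ A, M.eta₁ A - ε ≤ ∫ x, min (M.incr j (x 0)) B ∂(M.P₁ j)) ∧
    (∀ j ∉ A, M.eta₀ A - ε ≤ ∫ x, min (-M.incr j (x 0)) B ∂(M.P₀ j)) := by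
  have hK : 0 ≤ (Kv : ℝ) / (4 * ε) := by positivity
  refine ⟨fun j hj => ?_, fun j hj => ?_⟩
  · have hev : evariance (fun x => M.incr j (x 0)) (M.P₁ j) ≤ Kv := by
      rw [← evariance_congr (hM.streamLLR_one_ae_eq₁ j)]
      exact (hv j).2
    exact (sub_div_four_mul_le hε (by linarith) hB₁.le).trans
      (le_integral_min_of_evariance_le (M.measurable_incr_eval j 0) hev
        ((M.eta₁_le hj).trans_eq (hM.info₁_eq j)) (by linarith))
  · have hev : evariance (fun x => -M.incr j (x 0)) (M.P₀ j) ≤ Kv := by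
      have hae : (fun x => -streamLLR (M.P₀ j) (M.P₁ j) 1 x) =ᵐ[M.P₀ j]
          fun x => -M.incr j (x 0) := by
        filter_upwards [hM.streamLLR_one_ae_eq₀ j] with x hx
        rw [hx]
      rw [← evariance_congr hae]
      exact (hv j).1
    exact (sub_div_four_mul_le hε (by linarith) hB₀.le).trans
      (le_integral_min_of_evariance_le (M.measurable_incr_eval j 0).neg hev
        ((M.eta₀_le hj).trans_eq (hM.info₀_eq j)) (by linarith))

/-- For a fixed model there are finitely many streams, so convergence of each truncated mean
suffices and no second moment is required. -/
lemma IsIID.exists_sub_le_integral_min_incr (hM : M.IsIID) (hF : M.FiniteInfo)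
    (A : Finset (Fin J)) {ε : ℝ} (hε : 0 < ε) : ∃ B : ℝ, 0 ≤ B ∧
    (∀ j ∈ A, M.eta₁ A - ε ≤ ∫ x, min (M.incr j (x 0)) B ∂(M.P₁ j)) ∧
    (∀ j ∉ A, M.eta₀ A - ε ≤ ∫ x, min (-M.incr j (x 0)) B ∂(M.P₀ j)) := by
  have h₁ : ∀ᶠ B : ℕ in atTop, ∀ j, M.info₁ j - ε ≤ ∫ x, min (M.incr j (x 0)) B ∂(M.P₁ j) := by
    refine eventually_all.2 fun j => ?_
    have h := tendsto_integral_min (hM.integrable_incr₁ (hF j).2)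
    rw [← hM.info₁_eq] at h
    exact h.eventually_const_le (by linarith)
  have h₀ : ∀ᶠ B : ℕ in atTop, ∀ j, M.info₀ j - ε ≤ ∫ x, min (-M.incr j (x 0)) B ∂(M.P₀ j) := by
    refine eventually_all.2 fun j => ?_
    have h := tendsto_integral_min (hM.integrable_incr₀ (hF j).1).neg
    have h' : ∫ x, (-fun x => M.incr j (x 0)) x ∂(M.P₀ j) = M.info₀ j := (hM.info₀_eq j).symm
    rw [h'] at h
    exact h.eventually_const_le (by linarith)
  obtain ⟨B, hB₁, hB₀⟩ := (h₁.and h₀).exists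
  exact ⟨B, Nat.cast_nonneg B, fun j hj => (by linarith [M.eta₁_le hj] : _ ≤ _).trans (hB₁ j),
    fun j hj => (by linarith [M.eta₀_le hj] : _ ≤ _).trans (hB₀ j)⟩

lemma IsIID.exists_pos_le_info (hM : M.IsIID) (hF : M.FiniteInfo) (hJ : 0 < J) :
    ∃ r : ℝ, 0 < r ∧ ∀ j, r ≤ M.info₀ j ∧ r ≤ M.info₁ j := by
  have : Nonempty (Fin J) := ⟨⟨0, hJ⟩⟩
  obtain ⟨j, hj⟩ := Finite.exists_min fun j => min (M.info₀ j) (M.info₁ j)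
  exact ⟨min (M.info₀ j) (M.info₁ j),
    lt_min (hM.info₀_pos j (hM.integrable_incr₀ (hF j).1))
      (hM.info₁_pos j (hM.integrable_incr₁ (hF j).2)),
    fun k => ⟨(hj k).trans (min_le_left _ _), (hj k).trans (min_le_right _ _)⟩⟩

end StreamModel

theorem theorem3p1 :
    -- a fixed number of streams, of signals, and fixed constants
    (∀ (J m : ℕ) (hm : 1 ≤ m ∧ m < J) (M : StreamModel.{u} J) (E : M.ErrorMetric) (C₁ C₂ : ℝ),
      0 < C₁ → 0 < C₂ → E.UpperBound m hm C₁ → E.LowerBound m C₂ →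
      -- (1) admissibility
      (∀ α β : ℝ, 0 < α → α < 1 → 0 < β → β < 1 → 0 < gapThreshold J m C₁ α β →
        M.gapRule m hm (gapThreshold J m C₁ α β) ∈ E.controlling (exactClass J m) α β) ∧
      -- (2) asymptotic optimality as `α, β → 0`
      (M.IsIID → M.FiniteInfo → ∀ A ∈ exactClass J m,
        (∀ᶠ p : ℝ × ℝ in 𝓝[>] 0 ×ˢ 𝓝[>] 0,
          M.expT A (M.gapRule m hm (gapThreshold J m C₁ p.1 p.2)) ≠ ∞) ∧
        (fun p : ℝ × ℝ => (M.expT A (M.gapRule m hm (gapThreshold J m C₁ p.1 p.2))).toReal)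
          ~[𝓝[>] 0 ×ˢ 𝓝[>] 0]
          (fun p => |Real.log (min p.1 p.2)| / (M.eta₁ A + M.eta₀ A)) ∧
        (fun p : ℝ × ℝ => |Real.log (min p.1 p.2)| / (M.eta₁ A + M.eta₀ A))
          ~[𝓝[>] 0 ×ˢ 𝓝[>] 0]
          (fun p => (⨅ δ ∈ E.controlling (exactClass J m) p.1 p.2, M.expT A δ).toReal))) ∧
    -- (3) everything may vary with `α, β`
    (∀ {ι : Type v} (l : Filter ι) (α β : ι → ℝ) (J m : ι → ℕ) (hm : ∀ i, 1 ≤ m i ∧ m i < J i)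
      (M : ∀ i, StreamModel.{u} (J i)) (E : ∀ i, (M i).ErrorMetric) (C₁ C₂ : ι → ℝ),
      (∀ i, 0 < α i ∧ α i < 1) → (∀ i, 0 < β i ∧ β i < 1) →
      (∀ i, 0 < C₁ i) → (∀ i, 0 < C₂ i) →
      (∀ i, (E i).UpperBound (m i) (hm i) (C₁ i)) → (∀ i, (E i).LowerBound (m i) (C₂ i)) →
      (∀ i, 0 < gapThreshold (J i) (m i) (C₁ i) (α i) (β i) →
        (M i).gapRule (m i) (hm i) (gapThreshold (J i) (m i) (C₁ i) (α i) (β i)) ∈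
          (E i).controlling (exactClass (J i) (m i)) (α i) (β i)) ∧
      (Tendsto α l (𝓝 0) → Tendsto β l (𝓝 0) →
        ((fun i => (J i : ℝ)) =o[l] fun i => |Real.log (min (α i) (β i))| ^ (1 / 4 : ℝ)) →
        ((fun i => Real.log (C₁ i)) =o[l] fun i => |Real.log (min (α i) (β i))|) →
        ((fun i => Real.log (C₂ i)⁻¹) =o[l] fun i => |Real.log (min (α i) (β i))|) →
        Tendsto (fun i => max (α i) (β i) / C₂ i) l (𝓝 0) →
        (∀ i, (M i).IsIID) →
        (∃ r : ℝ, 0 < r ∧ ∀ i j, r ≤ (M i).info₀ j ∧ r ≤ (M i).info₁ j) →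
        (∃ K : NNReal, ∀ i j, (M i).var₀ j ≤ K ∧ (M i).var₁ j ≤ K) →
        ∀ A : ∀ i, Finset (Fin (J i)), (∀ i, A i ∈ exactClass (J i) (m i)) →
        (∃ K : ℝ, ∀ i, (M i).eta₁ (A i) + (M i).eta₀ (A i) ≤ K) →
        (∀ᶠ i in l, (M i).expT (A i) ((M i).gapRule (m i) (hm i)
          (gapThreshold (J i) (m i) (C₁ i) (α i) (β i))) ≠ ∞) ∧
        (fun i => ((M i).expT (A i) ((M i).gapRule (m i) (hm i)
            (gapThreshold (J i) (m i) (C₁ i) (α i) (β i)))).toReal)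
          ~[l] (fun i => |Real.log (min (α i) (β i))| /
            ((M i).eta₁ (A i) + (M i).eta₀ (A i))) ∧
        (fun i => |Real.log (min (α i) (β i))| / ((M i).eta₁ (A i) + (M i).eta₀ (A i)))
          ~[l] (fun i => (⨅ δ ∈ (E i).controlling (exactClass (J i) (m i)) (α i) (β i),
            (M i).expT (A i) δ).toReal))) := by
  refine ⟨?_, ?_⟩
  · intro J m hm M E C₁ C₂ hC₁ hC₂ hU hL
    refine ⟨fun α β hα _ hβ _ hc => M.gapRule_mem_controlling hm hC₁ hU hα hβ hc, ?_⟩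
    intro hM hF A hA
    obtain ⟨r, hr, hinfo⟩ := hM.exists_pos_le_info hF (by omega)
    have hα : Tendsto (fun p : ℝ × ℝ => p.1) (𝓝[>] 0 ×ˢ 𝓝[>] 0) (𝓝[>] 0) := tendsto_fst
    have hβ : Tendsto (fun p : ℝ × ℝ => p.2) (𝓝[>] 0 ×ˢ 𝓝[>] 0) (𝓝[>] 0) := tendsto_snd
    rw [tendsto_nhdsWithin_iff] at hα hβ
    have hLtop := tendsto_abs_log_min hα.1 hβ.1 hα.2 hβ.2
    have hconst : ∀ x : ℝ, (fun _ : ℝ × ℝ => x) =o[𝓝[>] 0 ×ˢ 𝓝[>] 0]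
        fun p => |Real.log (min p.1 p.2)| := fun x =>
      isLittleO_const_left.2 (Or.inr (tendsto_norm_atTop_atTop.comp hLtop))
    -- A fixed model is a constant family over the pairs of levels; the product filter imposes no
    -- relation between their rates.
    refine StreamModel.gapRule_isEquivalent (J := fun _ => J) (m := fun _ => m) (fun _ => hm)
      (M := fun _ => M) (E := fun _ => E) (C₁ := fun _ => C₁) (C₂ := fun _ => C₂)
      (A := fun _ => A) hα.2 hβ.2 (fun _ => hC₁) (fun _ => hC₂) (fun _ => hU) (fun _ => hL)
      hα.1 hβ.1 (hconst _) (hconst _) (hconst _) ?_ (fun _ => hM) hr (fun _ => hinfo)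
      (fun _ j => hM.integrable_incr₀ (hF j).1) (fun _ j => hM.integrable_incr₁ (hF j).2)
      (fun _ => hA) (fun _ => le_rfl) fun ε hε => ?_
    · simpa using (hα.1.max hβ.1).div_const C₂
    · obtain ⟨B, hB, h⟩ := hM.exists_sub_le_integral_min_incr hF A hε
      exact ⟨B, hB, fun _ => h⟩
  · intro ι l α β J m hm M E C₁ C₂ hα hβ hC₁ hC₂ hU hL
    refine ⟨fun i hc => (M i).gapRule_mem_controlling (hm i) (hC₁ i) (hU i) (hα i).1 (hβ i).1 hc,
      ?_⟩
    rintro hα0 hβ0 hJ hlog₁ hlog₂ hmax hM ⟨r, hr, hinfo⟩ ⟨Kv, hKv⟩ A hA ⟨K, hK⟩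
    have hαe : ∀ᶠ i in l, 0 < α i := Eventually.of_forall fun i => (hα i).1
    have hβe : ∀ᶠ i in l, 0 < β i := Eventually.of_forall fun i => (hβ i).1
    have hLtop := tendsto_abs_log_min hα0 hβ0 hαe hβe
    -- Growth of `J` slower than the logarithm itself is all the argument uses; the fourth root is
    -- smaller once the logarithm is at least one.
    have hJ' : (fun i => (J i : ℝ)) =o[l] fun i => |Real.log (min (α i) (β i))| := by
      refine hJ.trans_isBigO (IsBigO.of_bound 1 ?_)
      filter_upwards [hLtop.eventually_ge_atTop 1] with i hi
      rw [one_mul, Real.norm_eq_abs, Real.norm_eq_abs, abs_abs,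
        abs_of_nonneg (Real.rpow_nonneg (abs_nonneg _) _)]
      exact Real.rpow_le_self_of_one_le hi (by norm_num)
    refine StreamModel.gapRule_isEquivalent hm hαe hβe hC₁ hC₂ hU hL hα0 hβ0 hJ' hlog₁ hlog₂
      hmax hM hr hinfo
      (fun i j => (hM i).integrable_incr₀
        (StreamModel.integrable_of_info₀_pos (hr.trans_le (hinfo i j).1)))
      (fun i j => (hM i).integrable_incr₁
        (StreamModel.integrable_of_info₁_pos (hr.trans_le (hinfo i j).2)))
      hA hK fun ε hε => ?_
    have hq : 0 ≤ (Kv : ℝ) / (4 * ε) := by positivity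
    -- Both `η`'s are nonnegative with sum at most `K`, so each is at most `|K|`. The second term
    -- makes the variance loss at most `ε`, and the `1` makes the inequality strict.
    refine ⟨|K| + Kv / (4 * ε) + 1, by positivity, fun i => ?_⟩
    obtain ⟨j, -, hj⟩ := (M i).exists_eta₁_eq (hm i) (hA i)
    obtain ⟨k, -, hk⟩ := (M i).exists_eta₀_eq (hm i) (hA i)
    have h1 : 0 ≤ (M i).eta₁ (A i) := hj ▸ hr.le.trans (hinfo i j).2
    have h0 : 0 ≤ (M i).eta₀ (A i) := hk ▸ hr.le.trans (hinfo i k).1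
    have hKi := hK i
    have hKabs := le_abs_self K
    exact (hM i).sub_le_integral_min_incr (hKv i) hε (by linarith) (by linarith)
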